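/- Let $n,d\ge 0$ and let $\mathcal A=\{H_1,\dots,H_d\}$ be an arrangement of $d$ pairwise distinct affine hyperplanes $H_i=\{\ell_i=0\}$ in $\mathbb C^n$, where $\ell_i(x)=a_{i,1}x_1+\cdots+a_{i,n}x_n+c_i$ with $(a_{i,1},\dots,a_{i,n})\neq 0$. Let $f=\prod_{i=1}^d\ell_i$ be its defining polynomial. Write $B_R$ and $\mathring B_R$ for the closed and the open ball of radius $R$ centred at the origin of $\mathbb C^n$ (Euclidean norm), $D_\delta(c)\subset\mathbb C$ for the closed disk of radius $\delta$ centred at $c$, $D_r=D_r(0)$, and $T_r=f^{-1}(D_r)$. A map on a subset of a real vector space is smooth if near each point of the subset it extends to a $C^\infty$ map on an open set. A value $c\in\mathbb C$ is *regular at infinity* for $f$ if there are $\delta>0$ and $R_0>0$ such that for all $R\ge R_0$ the map $f:f^{-1}(D_\delta(c))\setminus B_R\to D_\delta(c)$ is a smooth locally trivial fibration (the fibre may be empty); $\mathcal B_{\mathit{inf}}(f)$ is the set of values that are not regular at infinity. Then: 1. For every $r>0$ there is $R_0>0$ such that for every $R\ge R_0$ there is a diffeomorphism $\Phi:\mathring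 B_R\cap T_r\to T_r$ with $f\circ\Phi=f$. 2. If the vectors $(a_{i,1},\dots,a_{i,n})$, $i=1,\dots,d$, span $\mathbb C^n$, then $\mathcal B_{\mathit{inf}}(f)\subseteq\{0\}$. 3. If $n=2$ and the lines of $\mathcal A$ are not all parallel, then $\mathcal B_{\mathit{inf}}(f)=\varnothing$. -/

import Mathlib

open Set
open scoped ContDiff

noncomputable section

/-- A map `φ` is smooth on an arbitrary subset `X` of a normed space if, near each point of `X`,
it extends to a `C^∞` map (over `ℝ`) on an open neighbourhood of the point. -/
def SmoothOnSet {E F : Type*} [NormedAddCommGroup E] [NormedSpace ℝ E]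
    [NormedAddCommGroup F] [NormedSpace ℝ F] (φ : E → F) (X : Set E) : Prop :=
  ∀ x ∈ X, ∃ U : Set E, IsOpen U ∧ x ∈ U ∧
    ∃ g : E → F, ContDiffOn ℝ ∞ g U ∧ EqOn φ g (X ∩ U)

/-- `φ` restricts to a diffeomorphism of the subset `X` onto the subset `Y`: it is a bijection
`X → Y`, smooth with smooth inverse `ψ`. The values of `φ` outside `X` are irrelevant. -/
def IsDiffeoBetween {E F : Type*} [NormedAddCommGroup E] [NormedSpace ℝ E]
    [NormedAddCommGroup F] [NormedSpace ℝ F] (φ : E → F) (X : Set E) (Y : Set F) : Prop :=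
  ∃ ψ : F → E, MapsTo φ X Y ∧ MapsTo ψ Y X ∧ LeftInvOn ψ φ X ∧ RightInvOn ψ φ Y ∧
    SmoothOnSet φ X ∧ SmoothOnSet ψ Y

/-- The map `f : X → D` (for `f '' X ⊆ D`) is a smooth locally trivial fibration: over a
neighbourhood `V ∩ D` in `D` of each `t ∈ D` there is a diffeomorphism
`X ∩ f⁻¹(V ∩ D) ≅ (V ∩ D) × (X ∩ f⁻¹(t))` whose first component is `f`.
The fibre may be empty. -/
def IsLocallyTrivialFibration {E : Type*} [NormedAddCommGroup E] [NormedSpace ℝ E]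
    (f : E → ℂ) (X : Set E) (D : Set ℂ) : Prop :=
  MapsTo f X D ∧
  ∀ t ∈ D, ∃ V : Set ℂ, IsOpen V ∧ t ∈ V ∧
    ∃ φ : E → ℂ × E,
      IsDiffeoBetween φ (X ∩ f ⁻¹' (V ∩ D)) ((V ∩ D) ×ˢ (X ∩ f ⁻¹' {t})) ∧
      ∀ z ∈ X ∩ f ⁻¹' (V ∩ D), (φ z).1 = f z

/-- The polynomial function `ℂⁿ → ℂ` of a polynomial. -/
def polyMap {n : ℕ} (f : MvPolynomial (Fin n) ℂ) (z : EuclideanSpace ℂ (Fin n)) : ℂ :=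
  MvPolynomial.eval (fun i => z i) f

/-- The tube `T_r = f⁻¹(D_r)`, with `D_r` the closed disk of radius `r` centred at `0`. -/
def tube {n : ℕ} (f : MvPolynomial (Fin n) ℂ) (r : ℝ) : Set (EuclideanSpace ℂ (Fin n)) :=
  polyMap f ⁻¹' Metric.closedBall 0 r

/-- `c` is a regular value at infinity of `f`: for some `δ > 0` (hence for every smaller one) and
all sufficiently large `R`, the map `f : f⁻¹(D_δ(c)) \ B_R → D_δ(c)` is a locally trivial
fibration. -/
def IsRegularValueAtInfinity {n : ℕ} (f : MvPolynomial (Fin n) ℂ) (c : ℂ) : Prop :=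
  ∃ δ : ℝ, 0 < δ ∧ ∃ R₀ : ℝ, 0 < R₀ ∧ ∀ R : ℝ, R₀ ≤ R →
    IsLocallyTrivialFibration (polyMap f)
      (polyMap f ⁻¹' Metric.closedBall c δ \ Metric.closedBall 0 R) (Metric.closedBall c δ)

/-- The set `B_inf` of irregular values at infinity. -/
def irregularValuesAtInfinity {n : ℕ} (f : MvPolynomial (Fin n) ℂ) : Set ℂ :=
  {c | ¬ IsRegularValueAtInfinity f c}

/-- An arrangement of `d` pairwise distinct affine hyperplanes in `ℂⁿ`, with a chosen equation
`a_{i,1} x_1 + ⋯ + a_{i,n} x_n + c_i = 0` of each. -/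
structure HyperplaneArrangement (n d : ℕ) where
  a : Fin d → Fin n → ℂ
  c : Fin d → ℂ
  a_ne_zero : ∀ i, a i ≠ 0
  distinct : Function.Injective fun i => {x : Fin n → ℂ | ∑ j, a i j * x j + c i = 0}

namespace HyperplaneArrangement

variable {n d : ℕ}

/-- The affine form `ℓ_i = a_{i,1} x_1 + ⋯ + a_{i,n} x_n + c_i`. -/
def form (A : HyperplaneArrangement n d) (i : Fin d) : MvPolynomial (Fin n) ℂ :=
  ∑ j, MvPolynomial.C (A.a i j) * MvPolynomial.X j + MvPolynomial.C (A.c i)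

/-- The defining polynomial `f = ∏ ℓ_i`. -/
def defPoly (A : HyperplaneArrangement n d) : MvPolynomial (Fin n) ℂ :=
  ∏ i, A.form i

/-- The arrangement is essential: the gradients of the `ℓ_i` span `ℂⁿ`. -/
def IsEssential (A : HyperplaneArrangement n d) : Prop :=
  Submodule.span ℂ (range A.a) = ⊤

/-- All hyperplanes of the arrangement are parallel to each other. -/
def AllParallel (A : HyperplaneArrangement n d) : Prop :=
  ∀ i j, ∃ u : ℂ, A.a j = u • A.a i

end HyperplaneArrangement

end

/-! ### Smoothness of superposition operators on spaces of continuous curves. -/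

noncomputable section Superposition

open scoped Topology

variable {K : Type*} [TopologicalSpace K] [CompactSpace K]

/-! Write `ℓ_i(z) = ⟨b_i, z⟩ + c_i` and `df = ⟨G, ·⟩`. The diffeomorphisms come from integrating
vector fields, so the question is where `G(z)` is a complex multiple of `z`, that is, where the
level of `f` is not transverse to the sphere through `z`. If this never happens outside a ball and
over a disk, the two coordinate fields of `ℂ` lift to fields `V` and `iV` tangent to the spheres;
their flows preserve the norm, so they are complete, and they trivialise `f`
(`isLocallyTrivialFibration_of_gradient_not_radial`). For the tube, a field tangent to the levels
and pointing outwards is enough: its flow, run for a time depending on `‖z‖`, stretches the ball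
part of the tube onto the whole tube (`exists_diffeo_tube_of_local_fields`).

The heart is an estimate for `L = ∑ conj(1/ℓ_i) b_i`, where `G = conj(f) L` off the zeros of `f`.
Let `z` go to infinity in the span of the normals, with limit direction `u` and `f` bounded and
nonzero. The forms with `⟨b_i, u⟩ ≠ 0` grow like `‖z‖` and contribute `O(1/‖z‖)` to `L`. Hence the
product of the other forms tends to `0`, and their part of `L` is at least `κ/(1 + ‖Pz‖)` by
`logGradBound`, where `P` projects onto the span of their normals and `‖Pz‖ = o(‖z‖)`. So `‖L‖‖z‖ →
∞` (`tendsto_norm_logGrad_mul_norm`). But `⟨L, u⟩` involves only the forms of the first kind and is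
`O(1/‖z‖)`, which is impossible if `L` is a multiple of `z`, because `z/‖z‖ → u`
(`exists_radius_logGrad_not_radial`).

On `f = 0`, let `J` be the set of forms vanishing at `z`. The span of their normals contains at most
one point of their flat, so it misses `z` when `z` is far away. The component of `z` orthogonal to
this span, corrected by an Euler field, is then tangent to the levels and points outwards
(`exists_local_field_of_zero`). In the plane, when the lines are not all parallel, at most one line
passes through a far point `z`; there `G(z)` is a nonzero multiple of its normal `b_i` and `z ∉ ℂ
b_i`, so `0` is regular too (`affProd_fibration_zero`). -/

/-- Pointwise application of a continuous family of continuous linear maps. -/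
def ContinuousMap.applyCLM (K : Type*) [TopologicalSpace K] [CompactSpace K]
    (E F : Type*) [NormedAddCommGroup E] [NormedSpace ℝ E]
    [NormedAddCommGroup F] [NormedSpace ℝ F] :
    C(K, E →L[ℝ] F) →L[ℝ] C(K, E) →L[ℝ] C(K, F) :=
  LinearMap.mkContinuous₂
    (LinearMap.mk₂ ℝ
      (fun (L : C(K, E →L[ℝ] F)) (h : C(K, E)) => (⟨fun s => L s (h s), by fun_prop⟩ : C(K, F)))
      (fun _ _ _ => by ext; simp) (fun _ _ _ => by ext; simp)
      (fun _ _ _ => by ext; simp) (fun _ _ _ => by ext; simp)) 1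
    (fun L h => by
      rw [one_mul]
      refine (ContinuousMap.norm_le _ (by positivity)).2 fun s => ?_
      refine ((L s).le_opNorm _).trans ?_
      gcongr
      exacts [L.norm_coe_le_norm s, h.norm_coe_le_norm s])

universe u

variable {E F : Type u} [NormedAddCommGroup E] [NormedSpace ℝ E]
  [NormedAddCommGroup F] [NormedSpace ℝ F]

/-- The superposition operator of a smooth compactly supported map is differentiable. -/
theorem hasFDerivAt_superposition {V : E → F} (hV : ContDiff ℝ ∞ V) (hc : HasCompactSupport V)
    (γ : C(K, E)) :
    HasFDerivAt (fun γ : C(K, E) => (⟨V, hV.continuous⟩ : C(E, F)).comp γ)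
      (ContinuousMap.applyCLM K E F
        ((⟨fderiv ℝ V, hV.continuous_fderiv (by simp)⟩ : C(E, E →L[ℝ] F)).comp γ)) γ := by
  -- Uniform continuity makes the first-order remainder of `V` small uniformly in the parameter `s`.
  have huc : UniformContinuous (fderiv ℝ V) :=
    (hc.fderiv ℝ).uniformContinuous_of_continuous (hV.continuous_fderiv (by simp))
  rw [hasFDerivAt_iff_isLittleO_nhds_zero, Asymptotics.isLittleO_iff]
  intro ε hε
  obtain ⟨δ, hδ, h⟩ := Metric.uniformContinuous_iff.1 huc ε hε
  filter_upwards [Metric.ball_mem_nhds (0 : C(K, E)) hδ] with η hη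
  rw [mem_ball_zero_iff] at hη
  refine (ContinuousMap.norm_le _ (by positivity)).2 fun s => ?_
  have hs : ‖η s‖ ≤ ‖η‖ := η.norm_coe_le_norm s
  have key := (convex_ball (γ s) δ).norm_image_sub_le_of_norm_hasFDerivWithin_le'
    (f := V) (f' := fderiv ℝ V) (φ := fderiv ℝ V (γ s)) (C := ε) (x := γ s) (y := γ s + η s)
    (fun x _ => (hV.differentiable (by simp) x).hasFDerivAt.hasFDerivWithinAt)
    (fun x hx => by
      have := h (a := x) (b := γ s) (by simpa using hx)
      rw [dist_eq_norm] at this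
      exact this.le)
    (Metric.mem_ball_self hδ) (by simpa using hs.trans_lt hη)
  simp only [add_sub_cancel_left] at key
  refine key.trans ?_
  gcongr

/-- The derivative is the superposition operator of `fderiv ℝ V` followed by a continuous linear
map, so induction trades `V` for `fderiv ℝ V`. This changes the target, which is why `F` is
quantified inside the induction and shares its universe with `E`. -/
theorem contDiff_superposition_nat (n : ℕ) : ∀ {F : Type u} [NormedAddCommGroup F]
    [NormedSpace ℝ F] {V : E → F} (hV : ContDiff ℝ ∞ V) (_ : HasCompactSupport V),
    ContDiff ℝ n (fun γ : C(K, E) => (⟨V, hV.continuous⟩ : C(E, F)).comp γ) := by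
  induction n with
  | zero =>
    intro F _ _ V hV _
    simp only [Nat.cast_zero, contDiff_zero]
    exact ContinuousMap.continuous_postcomp _
  | succ n ih =>
    intro F _ _ V hV hc
    push_cast
    rw [contDiff_succ_iff_hasFDerivAt]
    refine ⟨_, ?_, hasFDerivAt_superposition hV hc⟩
    exact (ContinuousMap.applyCLM K E F).contDiff.comp
      (ih (hV.fderiv_right (m := ∞) (by simp)) (hc.fderiv ℝ))

/-- The superposition operator `γ ↦ V ∘ γ` of a smooth compactly supported map is smooth. -/
theorem contDiff_superposition {V : E → F} (hV : ContDiff ℝ ∞ V) (hc : HasCompactSupport V) :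
    ContDiff ℝ ∞ (fun γ : C(K, E) => (⟨V, hV.continuous⟩ : C(E, F)).comp γ) :=
  contDiff_infty.2 fun n => contDiff_superposition_nat n hV hc

end Superposition

/-! ### Smooth local flows by Picard iteration and the implicit function theorem. -/

noncomputable section LocalFlow

open scoped Topology unitInterval NNReal

universe u

variable {E : Type u} [NormedAddCommGroup E] [NormedSpace ℝ E]

/-- The primitive vanishing at `0` of a continuous curve on the unit interval. -/
def ContinuousMap.primitive (γ : C(I, E)) : C(I, E) where
  toFun s := ∫ τ in (0 : ℝ)..s, γ (projIcc 0 1 zero_le_one τ)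
  continuous_toFun := by
    refine (intervalIntegral.continuous_primitive (fun a b => ?_) 0).comp continuous_subtype_val
    exact (γ.continuous.comp continuous_projIcc).intervalIntegrable _ _

theorem ContinuousMap.primitive_apply (γ : C(I, E)) (s : I) :
    γ.primitive s = ∫ τ in (0 : ℝ)..s, γ (projIcc 0 1 zero_le_one τ) := rfl

theorem ContinuousMap.norm_primitive_le (γ : C(I, E)) : ‖γ.primitive‖ ≤ ‖γ‖ := by
  refine (ContinuousMap.norm_le _ (norm_nonneg _)).2 fun s => ?_
  rw [ContinuousMap.primitive_apply]
  refine (intervalIntegral.norm_integral_le_of_norm_le_const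
    (C := ‖γ‖) fun τ _ => γ.norm_coe_le_norm _).trans ?_
  rw [sub_zero, abs_of_nonneg s.2.1]
  exact mul_le_of_le_one_right (norm_nonneg _) s.2.2

variable (E) in
/-- Integration of curves on the unit interval, as a continuous linear map. -/
def primitiveCLM : C(I, E) →L[ℝ] C(I, E) :=
  LinearMap.mkContinuous
    { toFun := ContinuousMap.primitive
      map_add' := fun γ η => by
        ext s
        have h (γ : C(I, E)) : IntervalIntegrable
          (fun τ : ℝ => γ (projIcc 0 1 zero_le_one τ)) MeasureTheory.volume 0 s :=
          (γ.continuous.comp continuous_projIcc).intervalIntegrable _ _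
        simp only [ContinuousMap.primitive_apply, ContinuousMap.add_apply]
        exact intervalIntegral.integral_add (h γ) (h η)
      map_smul' := fun c γ => by
        ext s
        simp [ContinuousMap.primitive_apply] } 1
    fun γ => by simpa using γ.norm_primitive_le

theorem norm_primitiveCLM_le : ‖primitiveCLM E‖ ≤ 1 :=
  LinearMap.mkContinuous_norm_le _ zero_le_one _

variable (E) in
/-- The inclusion of `E` as the constant curves. -/
def constCurveCLM : E →L[ℝ] C(I, E) :=
  LinearMap.mkContinuous
    { toFun := ContinuousMap.const I
      map_add' := fun _ _ => rfl
      map_smul' := fun _ _ => rfl } 1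
    fun x => by
      rw [one_mul]
      exact (ContinuousMap.norm_le _ (norm_nonneg _)).2 fun _ => le_rfl

@[simp]
theorem constCurveCLM_apply (x : E) (s : I) : constCurveCLM E x s = x := rfl

/-- The Picard operator of the rescaled equation `γ' = t V(γ)`, `γ 0 = x`. -/
def picardOp (V : C(E, E)) (t : ℝ) (x : E) (γ : C(I, E)) : C(I, E) :=
  constCurveCLM E x + t • primitiveCLM E (V.comp γ)

theorem picardOp_apply (V : C(E, E)) (t : ℝ) (x : E) (γ : C(I, E)) (s : I) :
    picardOp V t x γ s = x + t • ∫ τ in (0 : ℝ)..s, V (γ (projIcc 0 1 zero_le_one τ)) := rfl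

theorem lipschitzWith_picardOp {V : C(E, E)} {K : ℝ≥0} (hK : LipschitzWith K V) (t : ℝ) (x : E) :
    LipschitzWith (‖t‖₊ * K) (picardOp V t x) := by
  refine LipschitzWith.of_dist_le_mul fun γ η => ?_
  rw [dist_eq_norm, picardOp, picardOp, add_sub_add_left_eq_sub, ← smul_sub, ← map_sub, norm_smul]
  push_cast
  rw [mul_assoc]
  refine mul_le_mul_of_nonneg_left ?_ (norm_nonneg _)
  refine ((primitiveCLM E).le_of_opNorm_le norm_primitiveCLM_le _).trans ?_
  rw [one_mul]
  refine (ContinuousMap.norm_le _ (by positivity)).2 fun s => ?_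
  refine ((dist_eq_norm _ _).symm.le.trans (hK.dist_le_mul (γ s) (η s))).trans ?_
  gcongr
  exact ContinuousMap.dist_apply_le_dist s

theorem picardOp_fixedPoint_unique {V : C(E, E)} {K : ℝ≥0} (hK : LipschitzWith K V) {t : ℝ}
    (ht : ‖t‖₊ * K < 1) {x : E} {γ η : C(I, E)} (hγ : picardOp V t x γ = γ)
    (hη : picardOp V t x η = η) : γ = η := by
  have h : ContractingWith (‖t‖₊ * K) (picardOp V t x) := ⟨ht, lipschitzWith_picardOp hK t x⟩
  exact h.fixedPoint_unique' hγ hη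

/-- Following a solution of `γ' = t V(γ)` at speed `s` solves the equation with `t s`. With
uniqueness, the curve for time `t` at parameter `s` is the endpoint of the curve for time `t s`. -/
theorem picardOp_fixedPoint_rescale {V : C(E, E)} {t : ℝ} {x : E} {γ : C(I, E)}
    (hγ : picardOp V t x γ = γ) (s : I) :
    picardOp V (t * s) x (γ.comp ⟨fun ρ => s * ρ, by fun_prop⟩) =
      γ.comp ⟨fun ρ => s * ρ, by fun_prop⟩ := by
  ext ρ
  conv_rhs => rw [← hγ]
  rw [ContinuousMap.comp_apply, picardOp_apply, picardOp_apply, mul_smul]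
  congr 2
  have h : ∫ τ in (0 : ℝ)..ρ, V ((γ.comp ⟨fun ρ => s * ρ, by fun_prop⟩) (projIcc 0 1 zero_le_one τ))
      = ∫ τ in (0 : ℝ)..ρ, V (γ (projIcc 0 1 zero_le_one (s * τ))) := by
    refine intervalIntegral.integral_congr fun τ hτ => ?_
    rw [uIcc_of_le ρ.2.1] at hτ
    have h1 : τ ∈ Icc (0 : ℝ) 1 := ⟨hτ.1, hτ.2.trans ρ.2.2⟩
    have h2 : (s : ℝ) * τ ∈ Icc (0 : ℝ) 1 :=
      ⟨mul_nonneg s.2.1 h1.1, mul_le_one₀ s.2.2 h1.1 h1.2⟩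
    simp only [ContinuousMap.comp_apply]
    rw [projIcc_of_mem _ h1, projIcc_of_mem _ h2]
    rfl
  rw [h, intervalIntegral.smul_integral_comp_mul_left
    (fun τ => V (γ (projIcc 0 1 zero_le_one τ)))]
  simp

variable [CompleteSpace E]

theorem exists_picardOp_fixedPoint {V : C(E, E)} {K : ℝ≥0} (hK : LipschitzWith K V) :
    ∃ c : ℝ × E → C(I, E), ∀ p : ℝ × E, ‖p.1‖₊ * K < 1 → picardOp V p.1 p.2 (c p) = c p := by
  have (p : ℝ × E) : ∃ γ, ‖p.1‖₊ * K < 1 → picardOp V p.1 p.2 γ = γ := by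
    by_cases hp : ‖p.1‖₊ * K < 1
    · have h : ContractingWith (‖p.1‖₊ * K) (picardOp V p.1 p.2) :=
        ⟨hp, lipschitzWith_picardOp hK p.1 p.2⟩
      exact ⟨h.fixedPoint, fun _ => h.fixedPoint_isFixedPt⟩
    -- An arbitrary value where the operator need not contract.
    · exact ⟨0, fun h => absurd h hp⟩
  choose c hc using this
  exact ⟨c, hc⟩

theorem ContinuousLinearMap.isInvertible_id_sub {X : Type*} [NormedAddCommGroup X]
    [NormedSpace ℝ X] [CompleteSpace X] (A : X →L[ℝ] X) {q : ℝ} (hq₀ : 0 ≤ q) (hq : q < 1)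
    (h : ∀ x, ‖A x‖ ≤ q * ‖x‖) : (ContinuousLinearMap.id ℝ X - A).IsInvertible := by
  have hu : IsUnit (1 - A) := isUnit_one_sub_of_norm_lt_one ((A.opNorm_le_bound hq₀ h).trans_lt hq)
  obtain ⟨v, hv⟩ := hu
  exact ⟨ContinuousLinearEquiv.unitsEquiv ℝ _ v, hv⟩

/-- The fixed points of the Picard operator depend smoothly on time and on the initial value. -/
theorem contDiffAt_picardOp_fixedPoint {V : E → E} (hV : ContDiff ℝ ∞ V) (hc : HasCompactSupport V)
    {K : ℝ≥0} (hK : LipschitzWith K V) {c : ℝ × E → C(I, E)}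
    (hfix : ∀ p : ℝ × E, ‖p.1‖₊ * K < 1 → picardOp ⟨V, hV.continuous⟩ p.1 p.2 (c p) = c p)
    (p : ℝ × E) (hp : ‖p.1‖₊ * K < 1) : ContDiffAt ℝ ∞ c p := by
  set F : (ℝ × E) × C(I, E) → C(I, E) := fun q =>
    q.2 - picardOp ⟨V, hV.continuous⟩ q.1.1 q.1.2 q.2 with hF
  have hN := contDiff_superposition (K := I) hV hc
  have hFc : ContDiff ℝ ∞ F := by
    have h1 : ContDiff ℝ ∞ fun q : (ℝ × E) × C(I, E) => constCurveCLM E q.1.2 :=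
      (constCurveCLM E).contDiff.comp (contDiff_snd.comp contDiff_fst)
    have h2 : ContDiff ℝ ∞ fun q : (ℝ × E) × C(I, E) =>
        primitiveCLM E ((⟨V, hV.continuous⟩ : C(E, E)).comp q.2) :=
      (primitiveCLM E).contDiff.comp (hN.comp contDiff_snd)
    have h3 : ContDiff ℝ ∞ fun q : (ℝ × E) × C(I, E) => q.1.1 := contDiff_fst.comp contDiff_fst
    exact contDiff_snd.sub (h1.add (h3.smul h2))
  -- The partial derivative along curves is `id - t • (∫ ∘ N')`, a perturbation of the identity of
  -- norm less than `1` because `‖t‖ K < 1`.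
  have hinv : (fderiv ℝ F (p, c p) ∘L .inr ℝ (ℝ × E) C(I, E)).IsInvertible := by
    set N' := ContinuousMap.applyCLM I E E
        ((⟨fderiv ℝ V, hV.continuous_fderiv (by simp)⟩ : C(E, E →L[ℝ] E)).comp (c p)) with hN'
    have hd : HasFDerivAt (fun γ => F (p, γ))
        (ContinuousLinearMap.id ℝ C(I, E) - p.1 • (primitiveCLM E ∘L N')) (c p) := by
      refine (hasFDerivAt_id _).sub ?_
      have h := (primitiveCLM E).hasFDerivAt.comp _ (hasFDerivAt_superposition hV hc (c p))
      exact (h.const_smul p.1).const_add (constCurveCLM E p.2)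
    have hd' : HasFDerivAt (fun γ => F (p, γ))
        (fderiv ℝ F (p, c p) ∘L .inr ℝ (ℝ × E) C(I, E)) (c p) :=
      ((hFc.differentiable (by simp)) (p, c p)).hasFDerivAt.comp (c p)
        (hasFDerivAt_prodMk_right p (c p))
    rw [hd'.unique hd]
    refine ContinuousLinearMap.isInvertible_id_sub _ (q := ‖p.1‖ * K) (by positivity) hp fun h => ?_
    have hh : ‖N' h‖ ≤ K * ‖h‖ := by
      refine (ContinuousMap.norm_le _ (by positivity)).2 fun s => ?_
      refine ((fderiv ℝ V (c p s)).le_opNorm (h s)).trans ?_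
      gcongr
      · exact norm_fderiv_le_of_lipschitz ℝ hK
      · exact h.norm_coe_le_norm s
    have h1 : (p.1 • (primitiveCLM E ∘L N')) h = p.1 • primitiveCLM E (N' h) := rfl
    rw [h1, norm_smul, mul_assoc]
    gcongr
    refine ((primitiveCLM E).le_of_opNorm_le norm_primitiveCLM_le _).trans ?_
    rwa [one_mul]
  have hcd : ContDiffAt ℝ ∞ F (p, c p) := hFc.contDiffAt
  have h0 : F (p, c p) = 0 := sub_eq_zero.2 (hfix p hp).symm
  refine (hcd.contDiffAt_implicitFunction (by simp) hinv).congr_of_eventuallyEq ?_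
  have hopen : ∀ᶠ q : ℝ × E in 𝓝 p, ‖q.1‖₊ * K < 1 := by
    refine (IsOpen.mem_nhds ?_ hp)
    exact isOpen_lt (by fun_prop) continuous_const
  -- Uniqueness of fixed points identifies the implicit function with `c`; no continuity of `c` is
  -- needed beforehand.
  filter_upwards [hcd.eventually_apply_implicitFunction (by simp) hinv, hopen] with q hq hq1
  rw [h0] at hq
  exact picardOp_fixedPoint_unique (V := ⟨V, hV.continuous⟩) hK hq1 (hfix q hq1)
    (sub_eq_zero.1 hq).symm

/-- A smooth compactly supported vector field has a smooth flow for a short uniform time. -/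
theorem exists_smooth_local_flow {V : E → E} (hV : ContDiff ℝ ∞ V) (hc : HasCompactSupport V) :
    ∃ T : ℝ, 0 < T ∧ ∃ φ : ℝ × E → E, (∀ x, φ (0, x) = x) ∧
      (∀ p : ℝ × E, |p.1| < T → ContDiffAt ℝ ∞ φ p) ∧
      ∀ x t, |t| < T → HasDerivAt (fun s => φ (s, x)) (V (φ (t, x))) t := by
  obtain ⟨K, hK⟩ := hV.lipschitzWith_of_hasCompactSupport hc (by simp)
  obtain ⟨c, hfix⟩ := exists_picardOp_fixedPoint (V := ⟨V, hV.continuous⟩) hK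
  have hT {t : ℝ} (ht : |t| < ((K : ℝ) + 1)⁻¹) : ‖t‖₊ * K < 1 := by
    rw [← NNReal.coe_lt_coe]
    push_cast
    rw [Real.norm_eq_abs]
    calc |t| * K ≤ ((K : ℝ) + 1)⁻¹ * K := by gcongr
      _ < 1 := by
        rw [inv_mul_lt_iff₀ (by positivity)]
        linarith
  -- The flow at time `t` is the endpoint of the rescaled curve; `K + 1` allows `K = 0` and makes
  -- the contraction strict.
  refine ⟨((K : ℝ) + 1)⁻¹, by positivity, fun p => c p 1, fun x => ?_, fun p hp => ?_,
    fun x t ht => ?_⟩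
  · have h := congrArg (fun γ : C(I, E) => γ 1) (hfix (0, x) (by simp))
    simpa [picardOp_apply] using h.symm
  · have h := contDiffAt_picardOp_fixedPoint hV hc hK hfix p (hT hp)
    exact (ContinuousMap.evalCLM ℝ (1 : I)).contDiff.contDiffAt.comp p h
  · have hcont : ∀ s, |s| < ((K : ℝ) + 1)⁻¹ → ContinuousAt (fun s => c (s, x) 1) s := by
      intro s hs
      have h := (contDiffAt_picardOp_fixedPoint hV hc hK hfix (s, x) (hT hs)).continuousAt
      have h2 : ContinuousAt (fun s => c (s, x)) s :=
        ContinuousAt.comp (f := fun s : ℝ => (s, x)) h (by fun_prop)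
      exact (ContinuousMap.evalCLM ℝ (1 : I)).continuous.continuousAt.comp h2
    -- Rescaling turns the fixed point equation at parameter `1` into the integral equation in the
    -- time `s`.
    have hint : ∀ s, |s| < ((K : ℝ) + 1)⁻¹ →
        c (s, x) 1 = x + ∫ τ in (0 : ℝ)..s, V (c (τ, x) 1) := by
      intro s hs
      conv_lhs => rw [← hfix (s, x) (hT hs)]
      rw [picardOp_apply]
      have h : ∫ τ in (0 : ℝ)..(1 : I), V (c (s, x) (projIcc 0 1 zero_le_one τ)) =
          ∫ τ in (0 : ℝ)..(1 : ℝ), V (c (s * τ, x) 1) := by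
        refine intervalIntegral.integral_congr fun τ hτ => ?_
        rw [Icc.coe_one, uIcc_of_le zero_le_one] at hτ
        rw [projIcc_of_mem _ hτ]
        have hsτ : |s * τ| < ((K : ℝ) + 1)⁻¹ := by
          refine lt_of_le_of_lt ?_ hs
          rw [abs_mul, abs_of_nonneg hτ.1]
          exact mul_le_of_le_one_right (abs_nonneg _) hτ.2
        have := picardOp_fixedPoint_unique (V := ⟨V, hV.continuous⟩) hK (hT hsτ)
          (picardOp_fixedPoint_rescale (hfix (s, x) (hT hs)) ⟨τ, hτ⟩) (hfix (s * τ, x) (hT hsτ))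
        rw [← this]
        simp
      simp only [ContinuousMap.coe_mk] at *
      rw [h, intervalIntegral.smul_integral_comp_mul_left (fun τ => V (c (τ, x) 1))]
      simp
    have hmem : {s : ℝ | |s| < ((K : ℝ) + 1)⁻¹} ∈ 𝓝 t :=
      (isOpen_lt continuous_abs continuous_const).mem_nhds ht
    have hVc : ContinuousOn (fun s => V (c (s, x) 1)) {s : ℝ | |s| < ((K : ℝ) + 1)⁻¹} :=
      fun s hs => (hV.continuous.continuousAt.comp (hcont s hs)).continuousWithinAt
    have hd : HasDerivAt (fun s => x + ∫ τ in (0 : ℝ)..s, V (c (τ, x) 1)) (V (c (t, x) 1)) t := by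
      refine HasDerivAt.const_add _ (intervalIntegral.integral_hasDerivAt_right ?_ ?_ ?_)
      · refine (hVc.mono fun s hs => ?_).intervalIntegrable
        refine lt_of_le_of_lt ?_ ht
        rcases le_total 0 t with h0 | h0
        · rw [uIcc_of_le h0] at hs
          rw [abs_of_nonneg hs.1, abs_of_nonneg h0]
          exact hs.2
        · rw [uIcc_of_ge h0] at hs
          rw [abs_of_nonpos hs.2, abs_of_nonpos h0]
          linarith [hs.1]
      · exact ContinuousOn.stronglyMeasurableAtFilter
          (isOpen_lt continuous_abs continuous_const) hVc t ht
      · exact hV.continuous.continuousAt.comp (hcont t ht)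
    exact hd.congr_of_eventuallyEq (Filter.eventually_of_mem hmem hint)

end LocalFlow

/-! ### Global flows: compact support, then bounded radial growth. -/

noncomputable section GlobalFlow

open scoped Topology NNReal Manifold

universe u

section

variable {E : Type u} [NormedAddCommGroup E] [NormedSpace ℝ E]

theorem contMDiff_vectorField {V : E → E} (hV : ContDiff ℝ ∞ V) :
    CMDiff 1 (fun x => (⟨x, V x⟩ : TangentBundle 𝓘(ℝ, E) E)) :=
  contMDiff_vectorSpace_iff_contDiff.2 (hV.of_le (by simp))

theorem isMIntegralCurveOn_of_hasDerivAt {V : E → E} {γ : ℝ → E} {s : Set ℝ}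
    (h : ∀ t ∈ s, HasDerivAt γ (V (γ t)) t) :
    IsMIntegralCurveOn (M := E) (I := 𝓘(ℝ, E)) γ V s := by
  intro t ht
  exact (h t ht).hasFDerivAt.hasMFDerivAt.hasMFDerivWithinAt

theorem IsMIntegralCurve.hasDerivAt' {V : E → E} {γ : ℝ → E}
    (h : IsMIntegralCurve (M := E) (I := 𝓘(ℝ, E)) γ V) (t : ℝ) : HasDerivAt γ (V (γ t)) t := by
  have h1 : HasFDerivAt γ ((1 : ℝ →L[ℝ] ℝ).smulRight (V (γ t)) : ℝ →L[ℝ] E) t :=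
    hasMFDerivAt_iff_hasFDerivAt.1 (h t)
  simpa using h1.hasDerivAt

theorem ODE_solution_unique_of_contDiff {V : E → E} (hV : ContDiff ℝ ∞ V) {γ η : ℝ → E}
    (hγ : ∀ t, HasDerivAt γ (V (γ t)) t) (hη : ∀ t, HasDerivAt η (V (η t)) t) (h : γ 0 = η 0) :
    γ = η := by
  refine isMIntegralCurve_Ioo_eq_of_contMDiff_boundaryless (I := 𝓘(ℝ, E)) (t₀ := 0)
    (contMDiff_vectorField hV) ?_ ?_ h
  · exact isMIntegralCurve_iff_isMIntegralCurveOn.2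
      (isMIntegralCurveOn_of_hasDerivAt fun t _ => hγ t)
  · exact isMIntegralCurve_iff_isMIntegralCurveOn.2
      (isMIntegralCurveOn_of_hasDerivAt fun t _ => hη t)

/-- As functions of `s`, both sides solve the same autonomous equation and agree at `s = 0`. -/
theorem ODE_solution_flow_add {V : E → E} (hV : ContDiff ℝ ∞ V) {Φ : ℝ × E → E}
    (h0 : ∀ x, Φ (0, x) = x) (hΦ : ∀ x t, HasDerivAt (fun s => Φ (s, x)) (V (Φ (t, x))) t)
    (s t : ℝ) (x : E) : Φ (s, Φ (t, x)) = Φ (s + t, x) := by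
  refine congrFun (ODE_solution_unique_of_contDiff hV (γ := fun s => Φ (s, Φ (t, x)))
    (η := fun s => Φ (s + t, x)) (fun s => hΦ _ s) (fun s => ?_) ?_) s
  · exact (hΦ x (s + t)).comp_add_const s t
  · simp [h0]

variable [CompleteSpace E]

/-- A smooth compactly supported vector field has a global smooth flow. -/
theorem exists_smooth_flow_of_hasCompactSupport {V : E → E} (hV : ContDiff ℝ ∞ V)
    (hc : HasCompactSupport V) :
    ∃ Φ : ℝ × E → E, ContDiff ℝ ∞ Φ ∧ (∀ x, Φ (0, x) = x) ∧
      ∀ x t, HasDerivAt (fun s => Φ (s, x)) (V (Φ (t, x))) t := by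
  obtain ⟨T, hT, φ, hφ0, hφs, hφd⟩ := exists_smooth_local_flow hV hc
  have hglob (x : E) : ∃ γ : ℝ → E, γ 0 = x ∧
      IsMIntegralCurve (M := E) (I := 𝓘(ℝ, E)) γ V := by
    refine exists_isMIntegralCurve_of_isMIntegralCurveOn (contMDiff_vectorField hV) hT
      (fun x => ⟨fun t => φ (t, x), hφ0 x, isMIntegralCurveOn_of_hasDerivAt fun t ht => ?_⟩) x
    exact hφd x t (abs_lt.2 ht)
  choose X hX0 hX using hglob
  have hXd (x : E) (t : ℝ) : HasDerivAt (X x) (V (X x t)) t := (hX x).hasDerivAt' t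
  set Φ : ℝ × E → E := fun p => X p.2 p.1 with hΦ
  have hadd := ODE_solution_flow_add hV (Φ := Φ) hX0 hXd
  have hloc (t : ℝ) (ht : |t| < T) (x : E) : Φ (t, x) = φ (t, x) := by
    refine isMIntegralCurveOn_Ioo_eqOn_of_contMDiff_boundaryless (I := 𝓘(ℝ, E)) (t₀ := 0)
      (γ := X x) (γ' := fun t => φ (t, x)) (a := -T) (b := T) ⟨by linarith, hT⟩
      (contMDiff_vectorField hV) ((hX x).isMIntegralCurveOn _)
      (isMIntegralCurveOn_of_hasDerivAt fun t ht => hφd x t (abs_lt.2 ht)) ?_ (abs_lt.1 ht)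
    simp [hX0, hφ0]
  -- For short `t`, the flow at time `n t` is an `n`-fold iterate of the smooth local flow; a long
  -- time is reached by dividing it by a large `n`.
  have hn (n : ℕ) : ∀ p : ℝ × E, |p.1| < T →
      ContDiffAt ℝ ∞ (fun q : ℝ × E => Φ (n * q.1, q.2)) p := by
    induction n with
    | zero =>
      intro p _
      simp only [Nat.cast_zero, zero_mul]
      exact contDiffAt_snd.congr_of_eventuallyEq (Filter.Eventually.of_forall fun q => hX0 q.2)
    | succ n ih =>
      intro p hp
      have h1 : ContDiffAt ℝ ∞ (fun q : ℝ × E => φ (q.1, Φ (n * q.1, q.2))) p :=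
        ContDiffAt.comp (f := fun q : ℝ × E => (q.1, Φ (n * q.1, q.2))) p (hφs _ hp)
          (contDiffAt_fst.prodMk (ih p hp))
      refine h1.congr_of_eventuallyEq ?_
      filter_upwards [(isOpen_lt (by fun_prop) continuous_const).mem_nhds
        (show p ∈ {q : ℝ × E | |q.1| < T} from hp)] with q hq
      rw [← hloc _ hq, hadd]
      congr 2
      push_cast
      ring
  refine ⟨Φ, contDiff_iff_contDiffAt.2 fun p => ?_, hX0, hXd⟩
  obtain ⟨n, hnp⟩ := exists_nat_gt (|p.1| / T)
  have hn0 : (0 : ℝ) < n := lt_of_le_of_lt (by positivity) hnp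
  have hlt : |p.1 / n| < T := by
    rw [abs_div, abs_of_pos hn0, div_lt_iff₀ hn0]
    rw [div_lt_iff₀ hT] at hnp
    linarith
  have h1 := ContDiffAt.comp (f := fun q : ℝ × E => (q.1 / n, q.2)) p (hn n (p.1 / n, p.2) hlt)
    (by fun_prop)
  refine h1.congr_of_eventuallyEq (Filter.Eventually.of_forall fun q => ?_)
  simp [mul_div_cancel₀ _ hn0.ne']

end

variable {E : Type u} [NormedAddCommGroup E] [InnerProductSpace ℝ E] [FiniteDimensional ℝ E]

/-- A smooth vector field along which the squared norm grows at a bounded rate is complete, with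
smooth flow. -/
theorem exists_smooth_flow_of_inner_bound {V : E → E} (hV : ContDiff ℝ ∞ V) {C : ℝ}
    (hC : ∀ z, |inner ℝ z (V z)| ≤ C) :
    ∃ Φ : ℝ × E → E, ContDiff ℝ ∞ Φ ∧ (∀ x, Φ (0, x) = x) ∧
      ∀ x t, HasDerivAt (fun s => Φ (s, x)) (V (Φ (t, x))) t := by
  have hC0 : 0 ≤ C := (abs_nonneg _).trans (hC 0)
  -- The field is cut off outside growing balls. Bump functions lie between `0` and `1`, so the
  -- bound `C` survives with the same constant for all `n`.
  have hcut (n : ℕ) : ∃ Φ : ℝ × E → E, ∃ W : E → E, ContDiff ℝ ∞ W ∧ HasCompactSupport W ∧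
      (∀ z, ‖z‖ ≤ n → W z = V z) ∧ (∀ z, |inner ℝ z (W z)| ≤ C) ∧
      ContDiff ℝ ∞ Φ ∧ (∀ x, Φ (0, x) = x) ∧
      ∀ x t, HasDerivAt (fun s => Φ (s, x)) (W (Φ (t, x))) t := by
    let b : ContDiffBump (0 : E) := ⟨n + 1, n + 2, by positivity, by linarith⟩
    have hW : ContDiff ℝ ∞ fun z => b z • V z := b.contDiff.smul hV
    have hWc : HasCompactSupport fun z => b z • V z := b.hasCompactSupport.smul_right
    obtain ⟨Φ, h1, h2, h3⟩ := exists_smooth_flow_of_hasCompactSupport hW hWc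
    refine ⟨Φ, _, hW, hWc, fun z hz => ?_, fun z => ?_, h1, h2, h3⟩
    · rw [b.one_of_mem_closedBall (by simpa [b] using hz.trans (by linarith)), one_smul]
    · rw [inner_smul_right, abs_mul, abs_of_nonneg b.nonneg]
      exact (mul_le_of_le_one_left (abs_nonneg _) b.le_one).trans (hC z)
  choose Φ W hW hWc hWV hWC hΦs hΦ0 hΦd using hcut
  have hbound (n : ℕ) (x : E) (t : ℝ) : ‖Φ n (t, x)‖ ^ 2 ≤ ‖x‖ ^ 2 + 2 * C * |t| := by
    have hd (s : ℝ) : HasDerivAt (fun s => ‖Φ n (s, x)‖ ^ 2)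
        (2 * inner ℝ (Φ n (s, x)) (W n (Φ n (s, x)))) s := (hΦd n x s).norm_sq
    have h := (convex_univ (𝕜 := ℝ) (E := ℝ)).norm_image_sub_le_of_norm_hasDerivWithin_le
      (f := fun s => ‖Φ n (s, x)‖ ^ 2) (C := 2 * C) (x := 0) (y := t)
      (fun s _ => (hd s).hasDerivWithinAt)
      (fun s _ => by
        rw [Real.norm_eq_abs, abs_mul, abs_two]
        gcongr
        exact hWC n _) (mem_univ _) (mem_univ _)
    simp only [hΦ0, sub_zero, Real.norm_eq_abs] at h
    linarith [le_abs_self (‖Φ n (t, x)‖ ^ 2 - ‖x‖ ^ 2)]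
  have hin (n : ℕ) (m : ℕ) (x : E) (t : ℝ) (h : ‖x‖ ^ 2 + 2 * C * |t| < n) :
      ‖Φ m (t, x)‖ ≤ n := by
    -- The squared norm is below `n ≤ n ^ 2`, since `n` is a positive integer.
    have h1 := (hbound m x t).trans_lt h
    have h2 : (0 : ℝ) < n := lt_of_le_of_lt (by positivity) h
    have h3 : (1 : ℝ) ≤ n := by exact_mod_cast h2
    nlinarith [norm_nonneg (Φ m (t, x))]
  have hagree (n m : ℕ) (hnm : n ≤ m) (x : E) (t : ℝ) (h : ‖x‖ ^ 2 + 2 * C * |t| < n) :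
      Φ n (t, x) = Φ m (t, x) := by
    -- Room for an open time interval containing both `0` and `t`; in the witness, `2 * C + 1`
    -- avoids division by zero when `C = 0`.
    obtain ⟨δ, hδ, hδ'⟩ : ∃ δ > 0, ‖x‖ ^ 2 + 2 * C * (|t| + δ) < n := by
      refine ⟨(n - (‖x‖ ^ 2 + 2 * C * |t|)) / (2 * (2 * C + 1)), by
        apply div_pos <;> linarith, ?_⟩
      have : 2 * C * ((n - (‖x‖ ^ 2 + 2 * C * |t|)) / (2 * (2 * C + 1))) ≤
          (n - (‖x‖ ^ 2 + 2 * C * |t|)) / 2 := by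
        rw [← mul_div_assoc, div_le_div_iff₀ (by linarith) (by linarith)]
        nlinarith
      linarith
    have hlt (s : ℝ) (hs : s ∈ Ioo (-(|t| + δ)) (|t| + δ)) : ‖x‖ ^ 2 + 2 * C * |s| < n := by
      refine lt_of_le_of_lt ?_ hδ'
      gcongr
      exact (abs_lt.2 hs).le
    refine isMIntegralCurveOn_Ioo_eqOn_of_contMDiff_boundaryless (I := 𝓘(ℝ, E)) (t₀ := 0)
      (γ := fun t => Φ n (t, x)) (γ' := fun t => Φ m (t, x)) (a := -(|t| + δ)) (b := |t| + δ)
      ⟨by linarith [abs_nonneg t], by positivity⟩ (contMDiff_vectorField hV)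
      (isMIntegralCurveOn_of_hasDerivAt fun s hs => ?_)
      (isMIntegralCurveOn_of_hasDerivAt fun s hs => ?_) (by simp [hΦ0])
      (abs_lt.1 (by linarith))
    · rw [← hWV n _ (hin n n x s (hlt s hs))]
      exact hΦd n x s
    · rw [← hWV m _ ((hin n m x s (hlt s hs)).trans (by exact_mod_cast hnm))]
      exact hΦd m x s
  choose N hN using fun p : ℝ × E => exists_nat_gt (‖p.2‖ ^ 2 + 2 * C * |p.1|)
  have hloc (p : ℝ × E) (n : ℕ) (h : ‖p.2‖ ^ 2 + 2 * C * |p.1| < n) :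
      Φ (N p) p = Φ n p := by
    rcases le_total (N p) n with h1 | h1
    · exact hagree _ _ h1 _ _ (hN p)
    · exact (hagree _ _ h1 _ _ h).symm
  have hev (p : ℝ × E) : (fun q => Φ (N q) q) =ᶠ[𝓝 p] Φ (N p) := by
    have : {q : ℝ × E | ‖q.2‖ ^ 2 + 2 * C * |q.1| < N p} ∈ 𝓝 p :=
      (isOpen_lt (by fun_prop) continuous_const).mem_nhds (hN p)
    filter_upwards [this] with q hq using hloc q _ hq
  refine ⟨fun p => Φ (N p) p, contDiff_iff_contDiffAt.2 fun p => ?_, fun x => hΦ0 _ x,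
    fun x t => ?_⟩
  · exact (hΦs (N p)).contDiffAt.congr_of_eventuallyEq (hev p)
  · have h1 := hΦd (N (t, x)) x t
    rw [hWV _ _ (hin _ _ x t (hN (t, x)))] at h1
    refine h1.congr_of_eventuallyEq ?_
    exact (Continuous.tendsto (f := fun s : ℝ => (s, x)) (by fun_prop) t).eventually (hev (t, x))

end GlobalFlow

/-! ### Gluing of vector fields and comparison of solutions. -/

noncomputable section VectorFieldTools

open scoped Topology NNReal Manifold

/-- Smooth selections of a family of convex sets can be glued. -/
theorem exists_contDiff_forall_mem_convex_of_local {E F : Type*} [NormedAddCommGroup E]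
    [NormedSpace ℝ E] [FiniteDimensional ℝ E] [NormedAddCommGroup F] [NormedSpace ℝ F]
    {t : E → Set F} (ht : ∀ x, Convex ℝ (t x))
    (hloc : ∀ x, ∃ U ∈ 𝓝 x, ∃ g : E → F, ContDiffOn ℝ ∞ g U ∧ ∀ y ∈ U, g y ∈ t y) :
    ∃ g : E → F, ContDiff ℝ ∞ g ∧ ∀ x, g x ∈ t x := by
  obtain ⟨g, hg⟩ := exists_contMDiffMap_forall_mem_convex_of_local (n := ⊤) 𝓘(ℝ, E) ht
    (fun x => by
      obtain ⟨U, hU, g, hgs, hgt⟩ := hloc x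
      exact ⟨U, hU, g, hgs.contMDiffOn, hgt⟩)
  exact ⟨g, g.contMDiff.contDiff, hg⟩

/-- A solution of an autonomous equation which starts along a segment on which the field is the
constant `d` moves along this segment. -/
theorem ODE_solution_eq_of_segment {F : Type*} [NormedAddCommGroup F] [NormedSpace ℝ F]
    {χ : F → F} {K : ℝ≥0} (hχ : LipschitzWith K χ) {w : ℝ → F}
    (hw : ∀ s, HasDerivAt w (χ (w s)) s) {d : F} {a : ℝ}
    (hline : ∀ s ∈ Icc (0 : ℝ) 1, χ (w 0 + (s * a) • d) = d) : w a = w 0 + a • d := by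
  -- Time is rescaled by `a` to the interval `[0, 1]`, so that either sign of `a` is handled by
  -- forward uniqueness.
  have h := ODE_solution_unique (v := fun _ x => a • χ x) (K := ‖a‖₊ * K)
    (f := fun s => w (s * a)) (g := fun s => w 0 + (s * a) • d) (a := 0) (b := 1)
    (fun _ => ?_) ?_ ?_ (by fun_prop) ?_ (by simp) (right_mem_Icc.2 zero_le_one)
  · simpa using h
  · refine LipschitzWith.of_dist_le_mul fun x y => ?_
    rw [dist_smul₀]
    push_cast
    rw [mul_assoc]
    gcongr
    exact hχ.dist_le_mul x y
  · have : Continuous w := continuous_iff_continuousAt.2 fun s => (hw s).continuousAt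
    fun_prop
  · intro s _
    have := (hw (s * a)).scomp s ((hasDerivAt_id s).mul_const a)
    simpa [Function.comp_def] using this.hasDerivWithinAt
  · intro s hs
    rw [hline s ⟨hs.1, hs.2.le⟩]
    have := (((hasDerivAt_id s).mul_const a).smul_const d).const_add (w 0)
    simpa using this.hasDerivWithinAt

theorem SmoothOnSet.of_contDiffOn {E F : Type*} [NormedAddCommGroup E] [NormedSpace ℝ E]
    [NormedAddCommGroup F] [NormedSpace ℝ F] {φ : E → F} {X U : Set E} (hU : IsOpen U)
    (hXU : X ⊆ U) (h : ContDiffOn ℝ ∞ φ U) : SmoothOnSet φ X :=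
  fun _ hx => ⟨U, hU, hXU hx, φ, h, fun _ _ => rfl⟩

theorem SmoothOnSet.of_contDiff {E F : Type*} [NormedAddCommGroup E] [NormedSpace ℝ E]
    [NormedAddCommGroup F] [NormedSpace ℝ F] {φ : E → F} (h : ContDiff ℝ ∞ φ) (X : Set E) :
    SmoothOnSet φ X :=
  .of_contDiffOn isOpen_univ (subset_univ X) h.contDiffOn

universe u

variable {E : Type u} [NormedAddCommGroup E] [InnerProductSpace ℂ E]

theorem hasDerivAt_norm_sq_of_complex {γ : ℝ → E} {γ' : E} {t : ℝ} (h : HasDerivAt γ γ' t) :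
    HasDerivAt (fun s => ‖γ s‖ ^ 2) (2 * (inner ℂ (γ t) γ').re) t := by
  let _ := InnerProductSpace.rclikeToReal ℂ E
  exact HasDerivAt.norm_sq (F := E) h

theorem contDiff_inner_complex {F : Type*} [NormedAddCommGroup F] [NormedSpace ℝ F] {f g : F → E}
    {s : Set F} (hf : ContDiffOn ℝ ∞ f s) (hg : ContDiffOn ℝ ∞ g s) :
    ContDiffOn ℝ ∞ (fun x => inner ℂ (f x) (g x)) s :=
  hf.inner ℂ hg

variable [FiniteDimensional ℂ E]

/-- A smooth vector field along which the squared norm grows at a bounded rate is complete, with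
smooth flow (for a complex inner product). -/
theorem exists_smooth_flow_of_re_inner_bound {V : E → E} (hV : ContDiff ℝ ∞ V) {C : ℝ}
    (hC : ∀ z, |(inner ℂ z (V z)).re| ≤ C) :
    ∃ Φ : ℝ × E → E, ContDiff ℝ ∞ Φ ∧ (∀ x, Φ (0, x) = x) ∧
      (∀ x t, HasDerivAt (fun s => Φ (s, x)) (V (Φ (t, x))) t) ∧
      ∀ s t x, Φ (s, Φ (t, x)) = Φ (s + t, x) := by
  let _ := InnerProductSpace.rclikeToReal ℂ E
  have : FiniteDimensional ℝ E := FiniteDimensional.complexToReal E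
  obtain ⟨Φ, h1, h2, h3⟩ := exists_smooth_flow_of_inner_bound (E := E) hV hC
  exact ⟨Φ, h1, h2, h3, ODE_solution_flow_add hV h2 h3⟩

end VectorFieldTools

/-! ### Ehresmann's theorem at infinity by sphere-tangent lifts. -/

noncomputable section Fibration

open scoped Topology NNReal

universe u

variable {E : Type u} [NormedAddCommGroup E] [InnerProductSpace ℂ E]

/-- Along the flow of a field which pairs with the gradient `G` of `f` to a multiple of a cutoff
function of `f`, the value of `f` moves linearly. -/
theorem apply_flow_eq_add {f : E → ℂ} {G : E → E}
    (hfG : ∀ z, HasFDerivAt f (innerSL ℂ (G z)) z) {R₀ : ℝ} {χ : ℂ → ℝ} {K : ℝ≥0}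
    (hχ : LipschitzWith K χ) {θ : ℂ} (hθ : ‖θ‖ = 1) {W : E → E}
    (hW : ∀ z, R₀ ≤ ‖z‖ → inner ℂ (G z) (W z) = θ * χ (f z)) {Φ : ℝ × E → E}
    (hΦ0 : ∀ x, Φ (0, x) = x) (hΦ : ∀ x t, HasDerivAt (fun s => Φ (s, x)) (W (Φ (t, x))) t)
    (hnorm : ∀ t x, ‖Φ (t, x)‖ = ‖x‖) {z : E} (hz : R₀ ≤ ‖z‖) {a : ℝ}
    (hline : ∀ s ∈ Icc (0 : ℝ) 1, χ (f z + (s * a) • θ) = 1) :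
    f (Φ (a, z)) = f z + a • θ := by
  have hL : LipschitzWith K fun w : ℂ => θ * (χ w : ℂ) := by
    refine LipschitzWith.of_dist_le_mul fun x y => ?_
    rw [dist_eq_norm, ← mul_sub, norm_mul, hθ, one_mul, ← Complex.ofReal_sub, Complex.norm_real,
      ← dist_eq_norm]
    exact hχ.dist_le_mul x y
  have hd (s : ℝ) : HasDerivAt (fun s => f (Φ (s, z))) (θ * (χ (f (Φ (s, z))) : ℂ)) s := by
    rw [← hW _ (by rw [hnorm]; exact hz)]
    have h1 : HasFDerivAt f ((innerSL ℂ (G (Φ (s, z)))).restrictScalars ℝ) (Φ (s, z)) :=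
      (hfG _).restrictScalars ℝ
    exact h1.comp_hasDerivAt s (hΦ z s)
  have := ODE_solution_eq_of_segment hL hd (d := θ) (a := a) (fun s hs => by
    rw [hΦ0, hline s hs]
    simp)
  rwa [hΦ0] at this

theorem norm_flow_eq {W : E → E} (hW : ∀ z, inner ℂ z (W z) = 0) {Φ : ℝ × E → E}
    (hΦ0 : ∀ x, Φ (0, x) = x) (hΦ : ∀ x t, HasDerivAt (fun s => Φ (s, x)) (W (Φ (t, x))) t)
    (t : ℝ) (x : E) : ‖Φ (t, x)‖ = ‖x‖ := by
  have hd (s : ℝ) : HasDerivAt (fun s => ‖Φ (s, x)‖ ^ 2) 0 s := by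
    simpa [hW] using hasDerivAt_norm_sq_of_complex (hΦ x s)
  have h := is_const_of_deriv_eq_zero (fun s => (hd s).differentiableAt)
    (fun s => (hd s).deriv) t 0
  simp only [hΦ0] at h
  exact (sq_eq_sq₀ (norm_nonneg _) (norm_nonneg _)).1 h

/-- The trivialisation moves the real and the imaginary part of `f` separately, which may leave the
disk of radius `ε` but not its circumscribed square. The cutoff must therefore equal `1` on the disk
of radius `2 ε`. -/
theorem mem_closedBall_of_abs_re_of_abs_im {c w : ℂ} {ε : ℝ} (h1 : |w.re - c.re| ≤ ε)
    (h2 : |w.im - c.im| ≤ ε) : w ∈ Metric.closedBall c (2 * ε) := by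
  rw [mem_closedBall_iff_norm]
  refine (Complex.norm_le_abs_re_add_abs_im _).trans ?_
  simp only [Complex.sub_re, Complex.sub_im]
  linarith

theorem abs_sub_le_of_segment {x y c ε s : ℝ} (hs : s ∈ Icc (0 : ℝ) 1) (hx : |x - c| ≤ ε)
    (hy : |y - c| ≤ ε) : |x + s * (y - x) - c| ≤ ε := by
  rw [abs_le] at *
  obtain ⟨h0, h1⟩ := hs
  constructor <;> nlinarith

variable [FiniteDimensional ℂ E]

/-- Outside a ball, if the gradient of `f` is nowhere radial on `f ⁻¹ (D_{3ε}(c))`, there is a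
global smooth field tangent to the spheres on which `df` is a given cutoff of `f`. -/
theorem exists_sphere_tangent_field {f : E → ℂ} {G : E → E} (hG : ContDiff ℝ ∞ G)
    (hf : ContDiff ℝ ∞ f) {c : ℂ} {ε : ℝ} {R₀ : ℝ} (hR₀ : 0 < R₀)
    (h : ∀ z, R₀ ≤ ‖z‖ → ‖f z - c‖ ≤ 3 * ε → ∀ a : ℂ, G z ≠ a • z)
    {χ : ℂ → ℝ} (hχ : ContDiff ℝ ∞ χ) (hχ0 : ∀ w, 3 * ε < ‖w - c‖ → χ w = 0) :
    ∃ V : E → E, ContDiff ℝ ∞ V ∧ (∀ z, inner ℂ z (V z) = 0) ∧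
      ∀ z, R₀ ≤ ‖z‖ → inner ℂ (G z) (V z) = χ (f z) := by
  have : FiniteDimensional ℝ E := FiniteDimensional.complexToReal E
  -- Both conditions are affine in `v`, so local solutions glue. Orthogonality to `z` is complex, so
  -- that `i • v` is tangent to the spheres as well.
  let t (z : E) : Set E := {v | inner ℂ z v = 0 ∧ (R₀ ≤ ‖z‖ → inner ℂ (G z) v = χ (f z))}
  have ht (z : E) : Convex ℝ (t z) := by
    rintro v ⟨hv1, hv2⟩ w ⟨hw1, hw2⟩ a b _ _ hab
    refine ⟨?_, fun hz => ?_⟩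
    · rw [inner_add_right, inner_smul_right_eq_smul, inner_smul_right_eq_smul, hv1, hw1]
      simp
    · rw [inner_add_right, inner_smul_right_eq_smul, inner_smul_right_eq_smul, hv2 hz, hw2 hz,
        ← add_smul, hab, one_smul]
  obtain ⟨V, hV, hVt⟩ := exists_contDiff_forall_mem_convex_of_local ht fun x => by
    by_cases hx : R₀ ≤ ‖x‖ ∧ ‖f x - c‖ ≤ 3 * ε
    -- The component of `G` orthogonal to `y`, nonzero exactly where `G` is not radial. As `⟨G, p⟩ =
    -- ‖p‖ ^ 2`, the local solution is `χ(f) p / ‖p‖ ^ 2`.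
    · set p : E → E := fun y => G y - (inner ℂ y (G y) / (‖y‖ ^ 2 : ℝ) : ℂ) • y with hp
      have hx0 : x ≠ 0 := by
        rintro rfl
        simp only [norm_zero] at hx
        linarith [hx.1]
      have hpx : p x ≠ 0 := fun h0 => h x hx.1 hx.2 _ (sub_eq_zero.1 h0)
      have hps : ContDiffOn ℝ ∞ p {y | y ≠ 0} := by
        have h1 : ContDiffOn ℝ ∞ (fun y : E => inner ℂ y (G y)) {y | y ≠ 0} :=
          contDiff_inner_complex contDiffOn_id hG.contDiffOn
        have h2 : ContDiffOn ℝ ∞ (fun y : E => ((‖y‖ ^ 2 : ℝ) : ℂ)) {y | y ≠ 0} :=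
          Complex.ofRealCLM.contDiff.comp_contDiffOn ((contDiff_norm_sq ℂ).contDiffOn)
        have h3 : ContDiffOn ℝ ∞ (fun y : E => inner ℂ y (G y) / ((‖y‖ ^ 2 : ℝ) : ℂ))
          {y | y ≠ 0} := by
          have h4 : ∀ y ∈ {y : E | y ≠ 0}, ((‖y‖ ^ 2 : ℝ) : ℂ) ≠ 0 := fun y hy => by
            simpa using hy
          simp only [div_eq_mul_inv]
          exact h1.mul (h2.inv h4)
        exact hG.contDiffOn.sub (h3.smul contDiffOn_id)
      have hU1 : IsOpen {y : E | y ≠ 0} := isOpen_ne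
      have hU : IsOpen ({y : E | y ≠ 0} ∩ p ⁻¹' {0}ᶜ) :=
        hps.continuousOn.isOpen_inter_preimage hU1 isOpen_compl_singleton
      have horth (y : E) (hy : y ≠ 0) : inner ℂ y (p y) = 0 := by
        have : (‖y‖ : ℂ) ≠ 0 := by simpa using hy
        rw [hp]
        simp only [inner_sub_right, inner_smul_right, inner_self_eq_norm_sq_to_K]
        push_cast
        field_simp
        simp
      have hGp (y : E) (hy : y ≠ 0) : inner ℂ (G y) (p y) = (‖p y‖ ^ 2 : ℝ) := by
        have h1 : G y = p y + (inner ℂ y (G y) / (‖y‖ ^ 2 : ℝ) : ℂ) • y := by simp [hp]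
        conv_lhs => rw [h1]
        rw [inner_add_left, inner_smul_left, horth y hy, mul_zero, add_zero,
          inner_self_eq_norm_sq_to_K]
        push_cast
        rfl
      refine ⟨_, hU.mem_nhds ⟨hx0, hpx⟩, fun y => (χ (f y) / ‖p y‖ ^ 2) • p y, ?_, ?_⟩
      · have hps' := hps.mono (inter_subset_left (t := p ⁻¹' {0}ᶜ))
        have h1 : ContDiffOn ℝ ∞ (fun y => χ (f y) / ‖p y‖ ^ 2) ({y | y ≠ 0} ∩ p ⁻¹' {0}ᶜ) :=
          (hχ.comp hf).contDiffOn.div (hps'.norm_sq ℂ) fun y hy => by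
            have : p y ≠ 0 := hy.2
            simpa using this
        exact ContDiffOn.smul (f := fun y => χ (f y) / ‖p y‖ ^ 2) h1 hps'
      · rintro y ⟨hy, hpy⟩
        have hpy' : (‖p y‖ : ℂ) ≠ 0 := by simpa using hpy
        refine ⟨?_, fun _ => ?_⟩
        · rw [inner_smul_right_eq_smul, horth y hy, smul_zero]
        · rw [inner_smul_right_eq_smul, hGp y hy, Complex.real_smul]
          push_cast
          field_simp
    · have hU : IsOpen {y : E | ‖y‖ < R₀ ∨ 3 * ε < ‖f y - c‖} :=
        (isOpen_lt continuous_norm continuous_const).union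
          (isOpen_lt continuous_const (hf.continuous.sub continuous_const).norm)
      refine ⟨_, hU.mem_nhds ?_, fun _ => 0, contDiffOn_const, fun y hy => ⟨by simp, fun hy' => ?_⟩⟩
      · by_contra hcon
        exact hx (by simpa using hcon)
      · rw [hχ0 _ (hy.resolve_left (not_lt.2 hy'))]
        simp
  exact ⟨V, hV, fun z => (hVt z).1, fun z => (hVt z).2⟩

/-- Ehresmann's theorem at infinity: if, outside a ball and over a disk, the gradient of `f` is
nowhere radial, then `f` is a locally trivial fibration there. -/
theorem isLocallyTrivialFibration_of_gradient_not_radial {f : E → ℂ} {G : E → E}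
    (hG : ContDiff ℝ ∞ G) (hfG : ∀ z, HasFDerivAt f (innerSL ℂ (G z)) z) (hf : ContDiff ℝ ∞ f)
    {c : ℂ} {ε : ℝ} (hε : 0 < ε) {R₀ : ℝ} (hR₀ : 0 < R₀)
    (h : ∀ z, R₀ ≤ ‖z‖ → ‖f z - c‖ ≤ 3 * ε → ∀ a : ℂ, G z ≠ a • z) {R : ℝ} (hR : R₀ ≤ R) :
    IsLocallyTrivialFibration f (f ⁻¹' Metric.closedBall c ε \ Metric.closedBall 0 R)
      (Metric.closedBall c ε) := by
  -- Equal to `1` on the square swept by the motion, and zero off the disk where the gradient is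
  -- known not to be radial.
  let b : ContDiffBump c := ⟨2 * ε, 3 * ε, by positivity, by linarith⟩
  have hb1 (w : ℂ) (h1 : |w.re - c.re| ≤ ε) (h2 : |w.im - c.im| ≤ ε) : b w = 1 :=
    b.one_of_mem_closedBall (mem_closedBall_of_abs_re_of_abs_im h1 h2)
  obtain ⟨K, hK⟩ := ContDiff.lipschitzWith_of_hasCompactSupport (𝕂 := ℝ) (n := ∞)
    b.hasCompactSupport b.contDiff (by simp)
  obtain ⟨V, hV, hV1, hV2⟩ := exists_sphere_tangent_field hG hf hR₀ h (χ := b) b.contDiff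
    (fun w hw => b.zero_of_le_dist (by rw [dist_eq_norm]; exact hw.le))
  have hIV : ContDiff ℝ ∞ fun z => Complex.I • V z := contDiff_const.smul hV
  have hIV1 (z : E) : inner ℂ z (Complex.I • V z) = 0 := by rw [inner_smul_right, hV1, mul_zero]
  obtain ⟨Φ, hΦs, hΦ0, hΦd, hΦa⟩ := exists_smooth_flow_of_re_inner_bound hV (C := 0)
    (fun z => by simp [hV1])
  obtain ⟨Ψ, hΨs, hΨ0, hΨd, hΨa⟩ := exists_smooth_flow_of_re_inner_bound hIV (C := 0)
    (fun z => by simp [hIV1])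
  have hΦn := norm_flow_eq hV1 hΦ0 hΦd
  have hΨn := norm_flow_eq hIV1 hΨ0 hΨd
  have hΦf {z : E} (hz : R₀ ≤ ‖z‖) {x : ℝ} (h1 : |(f z).re - c.re| ≤ ε) (h1' : |x - c.re| ≤ ε)
      (h2 : |(f z).im - c.im| ≤ ε) : f (Φ (x - (f z).re, z)) = ⟨x, (f z).im⟩ := by
    rw [apply_flow_eq_add hfG hK (θ := 1) (by simp) (fun z hz => by simp [hV2 z hz]) hΦ0 hΦd hΦn hz
      fun s hs => hb1 _ (by simpa using abs_sub_le_of_segment hs h1 h1') (by simpa using h2)]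
    apply Complex.ext <;> simp
  have hΨf {z : E} (hz : R₀ ≤ ‖z‖) {y : ℝ} (h1 : |(f z).re - c.re| ≤ ε) (h2' : |y - c.im| ≤ ε)
      (h2 : |(f z).im - c.im| ≤ ε) : f (Ψ (y - (f z).im, z)) = ⟨(f z).re, y⟩ := by
    rw [apply_flow_eq_add hfG hK (θ := Complex.I) (by simp)
      (fun z hz => by rw [inner_smul_right, hV2 z hz]) hΨ0 hΨd hΨn hz
      fun s hs => hb1 _ (by simpa using h1) (by simpa using abs_sub_le_of_segment hs h2 h2')]
    apply Complex.ext <;> simp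
  have hre {w : ℂ} (hw : w ∈ Metric.closedBall c ε) : |w.re - c.re| ≤ ε := by
    rw [mem_closedBall_iff_norm] at hw
    exact (Complex.abs_re_le_norm (w - c)).trans hw
  have him {w : ℂ} (hw : w ∈ Metric.closedBall c ε) : |w.im - c.im| ≤ ε := by
    rw [mem_closedBall_iff_norm] at hw
    exact (Complex.abs_im_le_norm (w - c)).trans hw
  -- The fibration is trivial over the whole disk: the real part of `f` is flowed to that of `t`,
  -- then the imaginary part. The two flows need not commute, so the inverse runs them in the
  -- opposite order.
  refine ⟨fun z hz => hz.1, fun t ht => ⟨univ, isOpen_univ, mem_univ t,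
    fun z => (f z, Ψ (t.im - (f z).im, Φ (t.re - (f z).re, z))),
    ⟨fun q => Φ (q.1.re - t.re, Ψ (q.1.im - t.im, q.2)), ?_, ?_, ?_, ?_, ?_, ?_⟩, fun z _ => rfl⟩⟩
  · rintro z ⟨⟨hz, hzR⟩, -⟩
    have hzR' : R < ‖z‖ := by simpa using hzR
    have h1 := hΦf (hR.trans hzR'.le) (hre hz) (hre ht) (him hz)
    have h2 := hΨf (z := Φ (t.re - (f z).re, z)) (y := t.im) (by rw [hΦn]; exact hR.trans hzR'.le)
      (by simpa [h1] using hre ht) (him ht) (by simpa [h1] using him hz)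
    rw [h1] at h2
    simp only [Complex.eta] at h2
    refine ⟨⟨mem_univ _, hz⟩, ⟨?_, ?_⟩, h2⟩
    · rw [mem_preimage, h2]
      exact ht
    · simpa [hΦn, hΨn] using hzR'
  · rintro ⟨s, x⟩ ⟨⟨-, hs⟩, ⟨hx, hxR⟩, hxt⟩
    rw [mem_preimage, mem_singleton_iff] at hxt
    simp only at hs hx hxR hxt
    have hxR' : R < ‖x‖ := by simpa using hxR
    have h1 := hΨf (z := x) (y := s.im) (hR.trans hxR'.le) (hre hx) (him hs) (him hx)
    rw [hxt] at h1
    have h2 := hΦf (z := Ψ (s.im - t.im, x)) (x := s.re) (by rw [hΨn]; exact hR.trans hxR'.le)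
      (by simpa [h1] using hre ht) (hre hs) (by simpa [h1] using him hs)
    rw [h1] at h2
    simp only [Complex.eta] at h2
    refine ⟨⟨?_, ?_⟩, ⟨mem_univ _, ?_⟩⟩
    · simpa [h2] using hs
    · simpa [hΦn, hΨn] using hxR'
    · simpa [h2] using hs
  · rintro z -
    simp [hΨa, hΦa, hΨ0, hΦ0]
  · rintro ⟨s, x⟩ ⟨⟨-, hs⟩, ⟨hx, hxR⟩, hxt⟩
    rw [mem_preimage, mem_singleton_iff] at hxt
    simp only at hs hx hxR hxt
    have hxR' : R < ‖x‖ := by simpa using hxR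
    have h1 := hΨf (z := x) (y := s.im) (hR.trans hxR'.le) (hre hx) (him hs) (him hx)
    rw [hxt] at h1
    have h2 := hΦf (z := Ψ (s.im - t.im, x)) (x := s.re) (by rw [hΨn]; exact hR.trans hxR'.le)
      (by simpa [h1] using hre ht) (hre hs) (by simpa [h1] using him hs)
    rw [h1] at h2
    simp only [Complex.eta] at h2
    simp [h2, hΨa, hΦa, hΨ0, hΦ0]
  · refine SmoothOnSet.of_contDiff (hf.prodMk ?_) _
    have hre' : ContDiff ℝ ∞ fun z => (f z).re := Complex.reCLM.contDiff.comp hf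
    have him' : ContDiff ℝ ∞ fun z => (f z).im := Complex.imCLM.contDiff.comp hf
    exact hΨs.comp ((contDiff_const.sub him').prodMk
      (hΦs.comp ((contDiff_const.sub hre').prodMk contDiff_id)))
  · refine SmoothOnSet.of_contDiff ?_ _
    have hre' : ContDiff ℝ ∞ fun q : ℂ × E => q.1.re := Complex.reCLM.contDiff.comp contDiff_fst
    have him' : ContDiff ℝ ∞ fun q : ℂ × E => q.1.im := Complex.imCLM.contDiff.comp contDiff_fst
    exact hΦs.comp ((hre'.sub contDiff_const).prodMk
      (hΨs.comp ((him'.sub contDiff_const).prodMk contDiff_snd)))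

end Fibration

/-! ### Stretching a ball in a tube onto the whole tube. -/

noncomputable section Tube

open scoped Topology NNReal

/-- A smooth diffeomorphism of `(-∞, M)` onto `ℝ` which is the identity on `(-∞, m]`. -/
theorem exists_stretch {m M : ℝ} (hmM : m < M) :
    ∃ h k : ℝ → ℝ, ContDiffOn ℝ ∞ h (Iio M) ∧ ContDiff ℝ ∞ k ∧ (∀ x < M, k (h x) = x) ∧
      (∀ y, k y < M ∧ h (k y) = y) ∧ (∀ x ≤ m, h x = x) ∧ (∀ y ≤ m, k y = y) ∧
      (∀ x, m < x → x < M → m < h x) ∧ ∀ y, m < y → m < k y := by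
  -- Flat at `m`, infinite at `M` and nondecreasing, so `x + g x` is strictly increasing and
  -- unbounded with derivative at least `1`.
  set g : ℝ → ℝ := fun x => expNegInvGlue (x - m) / (M - x) with hg
  set h : ℝ → ℝ := fun x => x + g x with hh
  have hgm : MonotoneOn g (Iio M) := by
    intro x hx y hy hxy
    have hx' : 0 < M - x := sub_pos.2 hx
    have hy' : 0 < M - y := sub_pos.2 hy
    have := expNegInvGlue.monotone (sub_le_sub_right hxy m)
    have := expNegInvGlue.nonneg (y - m)
    simp only [hg]
    gcongr
  have hgs : ContDiffOn ℝ ∞ g (Iio M) := by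
    have h1 : ContDiff ℝ ∞ fun x => expNegInvGlue (x - m) :=
      expNegInvGlue.contDiff.comp (contDiff_id.sub contDiff_const)
    have h2 : ContDiff ℝ ∞ fun x => M - x := contDiff_const.sub contDiff_id
    exact h1.contDiffOn.div h2.contDiffOn fun x hx => (sub_pos.2 hx).ne'
  have hhs : ContDiffOn ℝ ∞ h (Iio M) := contDiffOn_id.add hgs
  have hmono : StrictMonoOn h (Iio M) := fun x hx y hy hxy =>
    add_lt_add_of_lt_of_le hxy (hgm hx hy hxy.le)
  have hle (x : ℝ) (hx : x ≤ m) : h x = x := by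
    simp [hh, hg, expNegInvGlue.zero_of_nonpos (sub_nonpos.2 hx)]
  have hsurj (y : ℝ) : ∃ x < M, h x = y := by
    set e := expNegInvGlue ((M - m) / 2) with he
    have he0 : 0 < e := expNegInvGlue.pos_of_pos (by linarith)
    set D := |y| + |m| + 1 with hD
    have hD0 : 0 < D := by positivity
    -- At distance `δ` from `M` the numerator of `g` is at least `e`, hence `g ≥ e / δ ≥ D`, enough
    -- to pass the value `y`.
    set δ := min ((M - m) / 2) (e / D) with hδ
    have hδ0 : 0 < δ := lt_min (by linarith) (by positivity)
    have hδ1 : δ ≤ (M - m) / 2 := min_le_left _ _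
    have hδ2 : δ ≤ e / D := min_le_right _ _
    have h1 : y ≤ h (M - δ) := by
      have h2 : D ≤ g (M - δ) := by
        simp only [hg, sub_sub_cancel]
        rw [le_div_iff₀ hδ0]
        calc D * δ ≤ D * (e / D) := by gcongr
          _ = e := mul_div_cancel₀ _ hD0.ne'
          _ ≤ _ := expNegInvGlue.monotone (by linarith)
      have h3 : h (M - δ) = M - δ + g (M - δ) := rfl
      linarith [le_abs_self y, neg_abs_le m]
    have hab : min y m ≤ M - δ := (min_le_right _ _).trans (by linarith)
    have hc : ContinuousOn h (Icc (min y m) (M - δ)) :=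
      hhs.continuousOn.mono fun x hx => lt_of_le_of_lt hx.2 (by linarith)
    obtain ⟨x, hx, hxy⟩ := intermediate_value_Icc hab hc
      ⟨(hle _ (min_le_right _ _)).le.trans (min_le_left _ _), h1⟩
    exact ⟨x, lt_of_le_of_lt hx.2 (by linarith), hxy⟩
  choose k hkM hhk using hsurj
  have hkh (x : ℝ) (hx : x < M) : k (h x) = x := hmono.injOn (hkM _) hx (hhk _)
  refine ⟨h, k, hhs, contDiff_iff_contDiffAt.2 fun y => ?_, hkh, fun y => ⟨hkM y, hhk y⟩, hle,
    fun y hy => ?_, fun x hx hxM => ?_, fun y hy => ?_⟩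
  · have hnhds : Iio M ∈ 𝓝 (k y) := Iio_mem_nhds (hkM y)
    have hca : ContDiffAt ℝ ∞ h (k y) := hhs.contDiffAt hnhds
    have hgd : DifferentiableAt ℝ g (k y) := (hgs.contDiffAt hnhds).differentiableAt (by simp)
    have hg0 : 0 ≤ deriv g (k y) := by
      rw [← derivWithin_of_mem_nhds hnhds]
      exact hgm.derivWithin_nonneg
    have hne : 1 + deriv g (k y) ≠ 0 := by positivity
    have hder : HasDerivAt h (1 + deriv g (k y)) (k y) := (hasDerivAt_id _).add hgd.hasDerivAt
    have hd : HasFDerivAt h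
        (ContinuousLinearEquiv.unitsEquivAut ℝ (Units.mk0 _ hne) : ℝ →L[ℝ] ℝ) (k y) := by
      convert! hder.hasFDerivAt using 1
    have hinv := hca.to_localInverse hd (by simp)
    rw [hhk] at hinv
    refine hinv.congr_of_eventuallyEq ?_
    have hstrict := hca.hasStrictFDerivAt' hd (by simp)
    have hcont : ContinuousAt (hca.localInverse hd (by simp)) y := hinv.continuousAt
    have hval : hca.localInverse hd (by simp) y = k y := by
      have := hca.localInverse_apply_image hd (by simp)
      rwa [hhk] at this
    have h1 := hstrict.eventually_right_inverse
    rw [hhk] at h1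
    -- The local inverse stays below `M` near `y`, where `k` is a left inverse of `h`; this
    -- identifies it with `k`.
    have h2 := hcont.eventually (show Iio M ∈ 𝓝 _ by rw [hval]; exact hnhds)
    filter_upwards [h1, h2] with z hz1 hz2
    have h3 := hkh _ hz2
    have hz1' : h (hca.localInverse hd (by simp) z) = z := hz1
    rw [hz1'] at h3
    exact h3
  · have := hkh y (hy.trans_lt hmM)
    rwa [hle y hy] at this
  · have := hmono hmM hxM hx
    rwa [hle m le_rfl] at this
  · by_contra hcon
    have h1 := hle _ (not_lt.1 hcon)
    rw [hhk] at h1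
    linarith

theorem exists_lipschitzWith_smoothTransition : ∃ K, LipschitzWith K Real.smoothTransition := by
  have hs : ContDiff ℝ ∞ Real.smoothTransition := Real.smoothTransition.contDiff
  have hc : HasCompactSupport (deriv Real.smoothTransition) := by
    refine HasCompactSupport.intro (isCompact_Icc (a := (0 : ℝ)) (b := 1)) fun x hx => ?_
    rw [mem_Icc, not_and_or, not_le, not_le] at hx
    rcases hx with hx | hx
    · refine (Filter.EventuallyEq.deriv_eq (f := fun _ => (0 : ℝ)) ?_).trans (deriv_const x 0)
      filter_upwards [Iio_mem_nhds hx] with y hy using Real.smoothTransition.zero_of_nonpos hy.le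
    · refine (Filter.EventuallyEq.deriv_eq (f := fun _ => (1 : ℝ)) ?_).trans (deriv_const x 1)
      filter_upwards [Ioi_mem_nhds hx] with y hy using Real.smoothTransition.one_of_one_le hy.le
  obtain ⟨C, hC⟩ := hc.exists_bound_of_continuous (hs.continuous_deriv (by simp))
  refine ⟨.mk (max C 0) (le_max_right _ _),
    lipschitzWith_of_nnnorm_deriv_le (hs.differentiable (by simp)) fun x => ?_⟩
  rw [← NNReal.coe_le_coe]
  exact (hC x).trans (le_max_left _ _)

universe u

variable {E : Type u} [NormedAddCommGroup E] [InnerProductSpace ℂ E] [FiniteDimensional ℂ E]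

/-- Local fields tangent to the levels of `f` and pointing outwards on a tube outside a ball glue
to a global field which leaves `f` invariant and moves outwards at a controlled speed. -/
theorem exists_level_tangent_field {f : E → ℂ} {G : E → E} (hf : Continuous f) {r R₀ : ℝ}
    (hR₀ : 0 < R₀)
    (h : ∀ z, R₀ ≤ ‖z‖ → ‖f z‖ ≤ r → ∃ U ∈ 𝓝 z, ∃ w : E → E, ContDiffOn ℝ ∞ w U ∧
      ∀ y ∈ U, inner ℂ (G y) (w y) = 0 ∧ 0 < (inner ℂ y (w y)).re) :
    ∃ V : E → E, ContDiff ℝ ∞ V ∧ (∀ z, inner ℂ (G z) (V z) = 0) ∧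
      (∀ z, |(inner ℂ z (V z)).re| ≤ 1 / 2) ∧
      ∀ z, ‖f z‖ ≤ r → (inner ℂ z (V z)).re = Real.smoothTransition (‖z‖ ^ 2 - R₀ ^ 2) / 2 := by
  have : FiniteDimensional ℝ E := FiniteDimensional.complexToReal E
  -- Convex conditions again: tangency to the levels, a global bound giving completeness, and on the
  -- tube a prescribed radial speed, for which `‖z‖ ^ 2` grows at rate `1` once it exceeds `R₀ ^ 2 +
  -- 1`.
  let t (z : E) : Set E := {v | inner ℂ (G z) v = 0 ∧ |(inner ℂ z v).re| ≤ 1 / 2 ∧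
    (‖f z‖ ≤ r → (inner ℂ z v).re = Real.smoothTransition (‖z‖ ^ 2 - R₀ ^ 2) / 2)}
  have ht (z : E) : Convex ℝ (t z) := by
    rintro v ⟨hv1, hv2, hv3⟩ w ⟨hw1, hw2, hw3⟩ a b ha hb hab
    have hre : (inner ℂ z (a • v + b • w)).re =
        a * (inner ℂ z v).re + b * (inner ℂ z w).re := by
      rw [inner_add_right, inner_smul_right_eq_smul, inner_smul_right_eq_smul]
      simp
    refine ⟨?_, ?_, fun hz => ?_⟩
    · rw [inner_add_right, inner_smul_right_eq_smul, inner_smul_right_eq_smul, hv1, hw1]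
      simp
    · rw [hre]
      rw [abs_le] at *
      constructor <;> nlinarith
    · rw [hre, hv3 hz, hw3 hz, ← add_mul, hab, one_mul]
  have hχ : ContDiff ℝ ∞ fun z : E => Real.smoothTransition (‖z‖ ^ 2 - R₀ ^ 2) :=
    Real.smoothTransition.contDiff.comp ((contDiff_norm_sq ℂ).sub contDiff_const)
  obtain ⟨V, hV, hVt⟩ := exists_contDiff_forall_mem_convex_of_local ht fun x => by
    by_cases hx : R₀ ≤ ‖x‖ ∧ ‖f x‖ ≤ r
    · obtain ⟨U, hU, w, hw, hwU⟩ := h x hx.1 hx.2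
      have hre : ContDiffOn ℝ ∞ (fun y => (inner ℂ y (w y)).re) U :=
        Complex.reCLM.contDiff.comp_contDiffOn (contDiff_inner_complex contDiffOn_id hw)
      have h1 : ContDiffOn ℝ ∞ (fun y => Real.smoothTransition (‖y‖ ^ 2 - R₀ ^ 2) /
          (2 * (inner ℂ y (w y)).re)) U :=
        hχ.contDiffOn.div (contDiffOn_const.mul hre) fun y hy => by
          have := (hwU y hy).2
          positivity
      refine ⟨U, hU, fun y => (Real.smoothTransition (‖y‖ ^ 2 - R₀ ^ 2) /
          (2 * (inner ℂ y (w y)).re)) • w y, ContDiffOn.smul (f := fun y =>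
          Real.smoothTransition (‖y‖ ^ 2 - R₀ ^ 2) / (2 * (inner ℂ y (w y)).re)) h1 hw,
        fun y hy => ?_⟩
      have hpos := (hwU y hy).2
      have hval : (inner ℂ y ((Real.smoothTransition (‖y‖ ^ 2 - R₀ ^ 2) /
          (2 * (inner ℂ y (w y)).re)) • w y)).re =
          Real.smoothTransition (‖y‖ ^ 2 - R₀ ^ 2) / 2 := by
        rw [inner_smul_right_eq_smul, Complex.smul_re, smul_eq_mul]
        field_simp
      refine ⟨?_, ?_, fun _ => hval⟩
      · rw [inner_smul_right_eq_smul, (hwU y hy).1, smul_zero]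
      · rw [hval, abs_of_nonneg (by
          have := Real.smoothTransition.nonneg (‖y‖ ^ 2 - R₀ ^ 2)
          positivity)]
        have := Real.smoothTransition.le_one (‖y‖ ^ 2 - R₀ ^ 2)
        linarith
    · have hU : IsOpen {y : E | ‖y‖ < R₀ ∨ r < ‖f y‖} :=
        (isOpen_lt continuous_norm continuous_const).union
          (isOpen_lt continuous_const hf.norm)
      refine ⟨_, hU.mem_nhds ?_, fun _ => 0, contDiffOn_const,
        fun y hy => ⟨by simp, by simp, fun hy' => ?_⟩⟩
      · by_contra hcon
        exact hx (by simpa using hcon)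
      · have hy'' : ‖y‖ < R₀ := hy.resolve_right (not_lt.2 hy')
        rw [Real.smoothTransition.zero_of_nonpos (by nlinarith [norm_nonneg y])]
        simp
  exact ⟨V, hV, fun z => (hVt z).1, fun z => (hVt z).2.1, fun z => (hVt z).2.2⟩

/-- If a tube of `f` carries, outside a ball, local fields which are tangent to the levels of `f`
and point outwards, then its intersection with any larger open ball is diffeomorphic to the whole
tube, compatibly with `f`. -/
theorem exists_diffeo_tube_of_local_fields {f : E → ℂ} {G : E → E}
    (hfG : ∀ z, HasFDerivAt f (innerSL ℂ (G z)) z) {r R₀ : ℝ} (hR₀ : 0 < R₀)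
    (h : ∀ z, R₀ ≤ ‖z‖ → ‖f z‖ ≤ r → ∃ U ∈ 𝓝 z, ∃ w : E → E, ContDiffOn ℝ ∞ w U ∧
      ∀ y ∈ U, inner ℂ (G y) (w y) = 0 ∧ 0 < (inner ℂ y (w y)).re) {R : ℝ} (hR : R₀ + 2 ≤ R) :
    ∃ Φ : E → E, IsDiffeoBetween Φ (Metric.ball 0 R ∩ f ⁻¹' Metric.closedBall 0 r)
        (f ⁻¹' Metric.closedBall 0 r) ∧
      ∀ z ∈ Metric.ball 0 R ∩ f ⁻¹' Metric.closedBall 0 r, f (Φ z) = f z := by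
  have hfc : Continuous f := continuous_iff_continuousAt.2 fun z => (hfG z).continuousAt
  obtain ⟨V, hV, hVG, hVb, hVr⟩ := exists_level_tangent_field hfc hR₀ h
  obtain ⟨Φ, hΦs, hΦ0, hΦd, hΦa⟩ := exists_smooth_flow_of_re_inner_bound hV hVb
  obtain ⟨K, hK⟩ := exists_lipschitzWith_smoothTransition
  have hK' : LipschitzWith K fun N => Real.smoothTransition (N - R₀ ^ 2) :=
    LipschitzWith.of_dist_le_mul fun x y => by
      have h := hK.dist_le_mul (x - R₀ ^ 2) (y - R₀ ^ 2)
      rwa [dist_sub_right] at h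
  have hΦf (t : ℝ) (x : E) : f (Φ (t, x)) = f x := by
    have hd (s : ℝ) : HasDerivAt (fun s => f (Φ (s, x))) 0 s := by
      have h1 : HasFDerivAt f ((innerSL ℂ (G (Φ (s, x)))).restrictScalars ℝ) (Φ (s, x)) :=
        (hfG _).restrictScalars ℝ
      have h2 := h1.comp_hasDerivAt s (hΦd x s)
      have h3 : ((innerSL ℂ (G (Φ (s, x)))).restrictScalars ℝ) (V (Φ (s, x))) = 0 := hVG _
      rwa [h3] at h2
    have h := is_const_of_deriv_eq_zero (fun s => (hd s).differentiableAt)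
      (fun s => (hd s).deriv) t 0
    simpa [hΦ0] using h
  have hΦN {z : E} (hz : ‖f z‖ ≤ r) {a : ℝ} (h0 : R₀ ^ 2 + 1 ≤ ‖z‖ ^ 2)
      (h1 : R₀ ^ 2 + 1 ≤ ‖z‖ ^ 2 + a) : ‖Φ (a, z)‖ ^ 2 = ‖z‖ ^ 2 + a := by
    have hd (s : ℝ) : HasDerivAt (fun s => ‖Φ (s, z)‖ ^ 2)
        (Real.smoothTransition (‖Φ (s, z)‖ ^ 2 - R₀ ^ 2)) s := by
      have h2 := hasDerivAt_norm_sq_of_complex (hΦd z s)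
      rwa [hVr _ (by rwa [hΦf]), mul_div_cancel₀ _ two_ne_zero] at h2
    have h3 := ODE_solution_eq_of_segment hK' hd (d := 1) (a := a) fun s hs => by
      rw [hΦ0]
      refine Real.smoothTransition.one_of_one_le ?_
      obtain ⟨hs0, hs1⟩ := hs
      simp only [smul_eq_mul, mul_one]
      nlinarith
    simpa [hΦ0] using h3
  -- Flowing for the time `η(‖z‖ ^ 2) - ‖z‖ ^ 2` turns the squared norm `N` into `η(N)`: below `R₀ ^
  -- 2 + 1` this time is zero, and above it the squared norm moves at unit speed.
  obtain ⟨η, κ, hη, hκ, hκη, hηκ, hη', hκ', hηm, hκm⟩ :=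
    exists_stretch (m := R₀ ^ 2 + 1) (M := R ^ 2) (by nlinarith)
  have hball {z : E} : z ∈ Metric.ball (0 : E) R ↔ ‖z‖ ^ 2 < R ^ 2 := by
    rw [mem_ball_zero_iff, sq_lt_sq₀ (norm_nonneg z) (by linarith)]
  have hN1 {z : E} (hz : ‖f z‖ ≤ r) (hzR : ‖z‖ ^ 2 < R ^ 2) :
      ‖Φ (η (‖z‖ ^ 2) - ‖z‖ ^ 2, z)‖ ^ 2 = η (‖z‖ ^ 2) := by
    rcases le_or_gt (‖z‖ ^ 2) (R₀ ^ 2 + 1) with h1 | h1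
    · simp [hη' _ h1, hΦ0]
    · rw [hΦN hz h1.le] <;> linarith [hηm _ h1 hzR]
  have hN2 {z : E} (hz : ‖f z‖ ≤ r) :
      ‖Φ (κ (‖z‖ ^ 2) - ‖z‖ ^ 2, z)‖ ^ 2 = κ (‖z‖ ^ 2) := by
    rcases le_or_gt (‖z‖ ^ 2) (R₀ ^ 2 + 1) with h1 | h1
    · simp [hκ' _ h1, hΦ0]
    · rw [hΦN hz h1.le] <;> linarith [hκm _ h1]
  refine ⟨fun z => Φ (η (‖z‖ ^ 2) - ‖z‖ ^ 2, z),
    ⟨fun z => Φ (κ (‖z‖ ^ 2) - ‖z‖ ^ 2, z), ?_, ?_, ?_, ?_, ?_, ?_⟩, fun z _ => hΦf _ _⟩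
  · rintro z ⟨-, hz⟩
    simpa [hΦf] using hz
  · intro z hz
    refine ⟨hball.2 ?_, by simpa [hΦf] using hz⟩
    rw [hN2 (by simpa using hz)]
    exact (hηκ _).1
  · rintro z ⟨hzR, hz⟩
    simp only
    rw [hN1 (by simpa using hz) (hball.1 hzR), hκη _ (hball.1 hzR), hΦa]
    simp [hΦ0]
  · intro z hz
    simp only
    rw [hN2 (by simpa using hz), (hηκ _).2, hΦa]
    simp [hΦ0]
  · refine SmoothOnSet.of_contDiffOn (Metric.isOpen_ball (x := (0 : E)) (ε := R))
      inter_subset_left (hΦs.comp_contDiffOn (ContDiffOn.prodMk (ContDiffOn.sub ?_ ?_)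
        contDiffOn_id))
    · exact hη.comp (contDiff_norm_sq ℂ).contDiffOn fun z hz => hball.1 hz
    · exact (contDiff_norm_sq ℂ).contDiffOn
  · exact SmoothOnSet.of_contDiff (hΦs.comp (((hκ.comp (contDiff_norm_sq ℂ)).sub
      (contDiff_norm_sq ℂ)).prodMk contDiff_id)) _

end Tube

/-! ### Asymptotics of the logarithmic gradient of a product of affine forms. -/

noncomputable section AffineForms

open scoped Topology ComplexConjugate
open Filter

universe u

variable {E : Type u} [NormedAddCommGroup E] [InnerProductSpace ℂ E]
variable {ι : Type*} (b : ι → E) (c : ι → ℂ)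

/-- The affine form `z ↦ ⟪b i, z⟫ + c i`. -/
def affForm (i : ι) (z : E) : ℂ := inner ℂ (b i) z + c i

/-- The vector representing the logarithmic derivative of the product of the affine forms
indexed by `s`. -/
def logGrad (s : Finset ι) (z : E) : E := ∑ i ∈ s, conj (affForm b c i z)⁻¹ • b i

theorem inner_logGrad (s : Finset ι) (z w : E) :
    inner ℂ (logGrad b c s z) w = ∑ i ∈ s, (affForm b c i z)⁻¹ * inner ℂ (b i) w := by
  simp [logGrad, mul_comm]

theorem continuous_affForm (i : ι) : Continuous (affForm b c i) :=
  (continuous_const.inner continuous_id).add continuous_const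

theorem affForm_sub_affForm (i : ι) (z w : E) :
    affForm b c i z - affForm b c i w = inner ℂ (b i) (z - w) := by
  simp [affForm]

/-- Near the zero set of the product of the affine forms indexed by `s`, the logarithmic gradient
is bounded below by a multiple of `1 / (1 + ‖z‖)`. -/
def LogGradBound (s : Finset ι) : Prop :=
  ∃ ε > 0, ∃ κ > 0, ∀ z, (∀ i ∈ s, affForm b c i z ≠ 0) → ‖∏ i ∈ s, affForm b c i z‖ < ε →
    κ ≤ ‖logGrad b c s z‖ * (1 + ‖z‖)

section Sequences

variable {z : ℕ → E} (hz : Tendsto (fun k => ‖z k‖) atTop atTop) {u : E}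
  (hu : Tendsto (fun k => (‖z k‖⁻¹ : ℝ) • z k) atTop (𝓝 u))

include hz hu

theorem tendsto_affForm_div_norm (i : ι) :
    Tendsto (fun k => ‖affForm b c i (z k)‖ * ‖z k‖⁻¹) atTop (𝓝 ‖(inner ℂ (b i) u : ℂ)‖) := by
  have h1 : Tendsto (fun k => (inner ℂ (b i) ((‖z k‖⁻¹ : ℝ) • z k) : ℂ) + (‖z k‖⁻¹ : ℝ) * c i)
      atTop (𝓝 (inner ℂ (b i) u + (0 : ℝ) * c i)) := by
    refine (tendsto_const_nhds.inner hu).add (Tendsto.mul_const _ ?_)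
    exact (Complex.continuous_ofReal.tendsto 0).comp hz.inv_tendsto_atTop
  have h2 := h1.norm
  simp only [Complex.ofReal_zero, zero_mul, add_zero] at h2
  refine h2.congr fun k => ?_
  rw [inner_smul_right_eq_smul, Complex.real_smul, ← mul_add, norm_mul, Complex.norm_real,
    norm_inv, norm_norm, mul_comm]
  rfl

theorem tendsto_norm_div_affForm {i : ι} (hi : (inner ℂ (b i) u : ℂ) ≠ 0) :
    Tendsto (fun k => ‖z k‖ * ‖affForm b c i (z k)‖⁻¹) atTop
      (𝓝 ‖(inner ℂ (b i) u : ℂ)‖⁻¹) := by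
  refine ((tendsto_affForm_div_norm b c hz hu i).inv₀ (by simpa using hi)).congr fun k => ?_
  rw [mul_inv, inv_inv, mul_comm]

theorem tendsto_norm_affForm_atTop {i : ι} (hi : (inner ℂ (b i) u : ℂ) ≠ 0) :
    Tendsto (fun k => ‖affForm b c i (z k)‖) atTop atTop := by
  refine ((tendsto_affForm_div_norm b c hz hu i).pos_mul_atTop (by simpa using hi) hz).congr' ?_
  filter_upwards [hz.eventually_gt_atTop 0] with k hk
  field_simp

end Sequences

/-- The span of the normal vectors of the forms indexed by `s`. -/
def normalSpan (s : Finset ι) : Submodule ℂ E := Submodule.span ℂ (b '' s)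

theorem mem_normalSpan_orthogonal {s : Finset ι} {z : E}
    (h : ∀ i ∈ s, (inner ℂ (b i) z : ℂ) = 0) : z ∈ (normalSpan b s)ᗮ := by
  intro w hw
  induction hw using Submodule.span_induction with
  | mem x hx =>
    obtain ⟨i, hi, rfl⟩ := hx
    exact h i hi
  | zero => simp
  | add x y _ _ hx hy => rw [inner_add_left, hx, hy, add_zero]
  | smul a x _ hx => rw [inner_smul_left, hx, mul_zero]

theorem eq_zero_of_mem_normalSpan {s : Finset ι} {z : E} (hz : z ∈ normalSpan b s)
    (h : ∀ i ∈ s, (inner ℂ (b i) z : ℂ) = 0) : z = 0 := by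
  have := mem_normalSpan_orthogonal b h z hz
  simpa using this

/-- The points of the flats closest to the origin lie in a ball. -/
theorem exists_radius_notMem_normalSpan [Finite ι] :
    ∃ R₀ > 0, ∀ (J : Finset ι) (z : E), R₀ ≤ ‖z‖ → (∀ i ∈ J, affForm b c i z = 0) →
      z ∉ normalSpan b J := by
  have := Fintype.ofFinite ι
  have hJ (J : Finset ι) : ∃ R : ℝ, ∀ z ∈ normalSpan b J, (∀ i ∈ J, affForm b c i z = 0) →
      ‖z‖ ≤ R := by
    by_cases h : ∃ w ∈ normalSpan b J, ∀ i ∈ J, affForm b c i w = 0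
    · obtain ⟨w, hw, hw0⟩ := h
      -- Two points of the flat of `J` differ by a vector orthogonal to the normals; if both lie in
      -- the span of the normals they coincide. So each `J` excludes at most one point.
      refine ⟨‖w‖, fun z hz hz0 => le_of_eq (congrArg _ (sub_eq_zero.1 ?_))⟩
      refine eq_zero_of_mem_normalSpan b (Submodule.sub_mem _ hz hw) fun i hi => ?_
      rw [← affForm_sub_affForm b c, hz0 i hi, hw0 i hi, sub_zero]
    · exact ⟨0, fun z hz hz0 => absurd ⟨z, hz, hz0⟩ h⟩
  choose R hR using hJ
  refine ⟨∑ J : Finset ι, |R J| + 1, by positivity, fun J z hz hz0 hzJ => ?_⟩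
  have h1 := hR J z hzJ hz0
  have h2 : |R J| ≤ ∑ J : Finset ι, |R J| :=
    Finset.single_le_sum (f := fun J => |R J|) (fun _ _ => abs_nonneg _) (Finset.mem_univ J)
  linarith [le_abs_self (R J)]

variable [FiniteDimensional ℂ E]

theorem inner_starProjection_normalSpan {s : Finset ι} {i : ι} (hi : i ∈ s) (z : E) :
    (inner ℂ (b i) ((normalSpan b s).starProjection z) : ℂ) = inner ℂ (b i) z := by
  have h : b i ∈ normalSpan b s := Submodule.subset_span (mem_image_of_mem b hi)
  rw [← sub_eq_zero, ← inner_sub_right, ← neg_sub, inner_neg_right, neg_eq_zero]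
  exact Submodule.sub_starProjection_mem_orthogonal z _ h

/-- The forms indexed by `s` see only the projection to the span of their normals. Lower bounds in
terms of `‖z‖` thus improve to bounds in terms of the norm of the projection. -/
theorem affForm_starProjection {s : Finset ι} {i : ι} (hi : i ∈ s) (z : E) :
    affForm b c i ((normalSpan b s).starProjection z) = affForm b c i z := by
  rw [affForm, affForm, inner_starProjection_normalSpan b hi]

theorem logGrad_starProjection (s : Finset ι) (z : E) :
    logGrad b c s ((normalSpan b s).starProjection z) = logGrad b c s z :=
  Finset.sum_congr rfl fun i hi => by rw [affForm_starProjection b c hi]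

/-- Along a sequence going to infinity in the direction `u` on which the product of the forms is
bounded, the logarithmic gradient is much larger than `1 / ‖z‖`. -/
theorem tendsto_norm_logGrad_mul_norm {s : Finset ι} (hL : ∀ J ⊂ s, LogGradBound b c J)
    {z : ℕ → E} (hz : Tendsto (fun k => ‖z k‖) atTop atTop) {u : E}
    (hu : Tendsto (fun k => (‖z k‖⁻¹ : ℝ) • z k) atTop (𝓝 u))
    (hs : ∃ i ∈ s, (inner ℂ (b i) u : ℂ) ≠ 0) (hne : ∀ k, ∀ i ∈ s, affForm b c i (z k) ≠ 0)
    {r : ℝ} (hr : ∀ k, ‖∏ i ∈ s, affForm b c i (z k)‖ ≤ r) :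
    Tendsto (fun k => ‖logGrad b c s (z k)‖ * ‖z k‖) atTop atTop := by
  classical
  -- The forms in `J` are `o(‖z‖)`, while those in the complement `J'` grow like `‖z‖`.
  set J := s.filter fun i => (inner ℂ (b i) u : ℂ) = 0 with hJ
  set J' := s.filter fun i => ¬ (inner ℂ (b i) u : ℂ) = 0 with hJ'
  have hJs : J ⊂ s := by
    obtain ⟨i, hi, hiu⟩ := hs
    refine (Finset.filter_subset _ _).ssubset_of_mem_notMem hi fun h => hiu ?_
    exact (Finset.mem_filter.1 h).2
  obtain ⟨ε, hε, κ, hκ, hLJ⟩ := hL J hJs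
  have hJ'ne : J'.card ≠ 0 := by
    obtain ⟨i, hi, hiu⟩ := hs
    exact Finset.card_ne_zero_of_mem (Finset.mem_filter.2 ⟨hi, hiu⟩)
  have hsmall : ∀ᶠ k in atTop, ‖∏ i ∈ J, affForm b c i (z k)‖ < ε := by
    -- If the product over `J` were at least `ε`, the full product would be at least `ε (r / ε + 1)
    -- = r + ε > r`. The `max` with `1` keeps further factors from shrinking the product.
    have h1 : ∀ᶠ k in atTop, ∀ i ∈ J', max 1 (r / ε + 1) ≤ ‖affForm b c i (z k)‖ := by
      rw [Filter.eventually_all_finset]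
      intro i hi
      exact (tendsto_norm_affForm_atTop b c hz hu (Finset.mem_filter.1 hi).2).eventually_ge_atTop _
    filter_upwards [h1] with k hk
    have h2 : r / ε + 1 ≤ ‖∏ i ∈ J', affForm b c i (z k)‖ := by
      rw [norm_prod]
      calc r / ε + 1 ≤ max 1 (r / ε + 1) := le_max_right _ _
        _ ≤ max 1 (r / ε + 1) ^ J'.card := le_self_pow₀ (le_max_left _ _) hJ'ne
        _ = ∏ i ∈ J', max 1 (r / ε + 1) := by simp
        _ ≤ _ := Finset.prod_le_prod (fun _ _ => by positivity) hk
    have h3 := hr k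
    rw [← Finset.prod_filter_mul_prod_filter_not s fun i => (inner ℂ (b i) u : ℂ) = 0,
      norm_mul] at h3
    by_contra hcon
    rw [not_lt] at hcon
    have hr0 : 0 ≤ r := (norm_nonneg _).trans (hr k)
    have h4 : ε * (r / ε + 1) ≤ r := by
      refine le_trans ?_ h3
      gcongr
    rw [mul_add, mul_div_cancel₀ _ hε.ne'] at h4
    linarith
  set P := (normalSpan b J).starProjection with hP
  have hPu : P u = 0 := by
    rw [hP, Submodule.starProjection_apply_eq_zero_iff]
    exact mem_normalSpan_orthogonal b fun i hi => (Finset.mem_filter.1 hi).2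
  -- The direction `u` is orthogonal to the normals of `J`, so the projection is negligible against
  -- `‖z‖`; this makes the bound for `J` dominate the `O(1 / ‖z‖)` of `J'`.
  have hratio : Tendsto (fun k => (1 + ‖P (z k)‖) * ‖z k‖⁻¹) atTop (𝓝 0) := by
    have h1 : Tendsto (fun k => ‖P ((‖z k‖⁻¹ : ℝ) • z k)‖) atTop (𝓝 ‖P u‖) :=
      ((P.continuous.tendsto u).comp hu).norm
    rw [hPu, norm_zero] at h1
    have h2 := hz.inv_tendsto_atTop.add h1
    rw [add_zero] at h2
    refine h2.congr fun k => ?_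
    have : P ((‖z k‖⁻¹ : ℝ) • z k) = (‖z k‖⁻¹ : ℝ) • P (z k) :=
      (P.restrictScalars ℝ).map_smul _ _
    rw [this, norm_smul, norm_inv, norm_norm, Pi.inv_apply]
    ring
  have hinv : Tendsto (fun k => κ * ((1 + ‖P (z k)‖) * ‖z k‖⁻¹)⁻¹) atTop atTop := by
    refine Tendsto.const_mul_atTop hκ (Tendsto.inv_tendsto_nhdsGT_zero ?_)
    refine tendsto_nhdsWithin_iff.2 ⟨hratio, ?_⟩
    filter_upwards [hz.eventually_gt_atTop 0] with k hk
    rw [mem_Ioi]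
    positivity
  have hrest : Tendsto (fun k => -∑ i ∈ J', ‖b i‖ * (‖z k‖ * ‖affForm b c i (z k)‖⁻¹)) atTop
      (𝓝 (-∑ i ∈ J', ‖b i‖ * ‖(inner ℂ (b i) u : ℂ)‖⁻¹)) :=
    (tendsto_finsetSum _ fun i hi =>
      (tendsto_norm_div_affForm b c hz hu (Finset.mem_filter.1 hi).2).const_mul _).neg
  refine tendsto_atTop_mono' _ ?_ (hinv.atTop_add hrest)
  filter_upwards [hsmall, hz.eventually_gt_atTop 0] with k hk hzk
  have h1 := hLJ (P (z k)) (fun i hi => by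
      rw [affForm_starProjection b c hi]
      exact hne k i (Finset.mem_of_mem_filter i hi))
    (by
      rwa [Finset.prod_congr rfl fun i hi => affForm_starProjection b c hi (z k)])
  rw [logGrad_starProjection] at h1
  have h2 : logGrad b c s (z k) = logGrad b c J (z k) + logGrad b c J' (z k) :=
    (Finset.sum_filter_add_sum_filter_not s _ _).symm
  have h3 : ‖logGrad b c J' (z k)‖ * ‖z k‖ ≤
      ∑ i ∈ J', ‖b i‖ * (‖z k‖ * ‖affForm b c i (z k)‖⁻¹) := by
    calc ‖logGrad b c J' (z k)‖ * ‖z k‖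
        ≤ (∑ i ∈ J', ‖conj (affForm b c i (z k))⁻¹ • b i‖) * ‖z k‖ := by
          gcongr
          exact norm_sum_le _ _
      _ = _ := by
          rw [Finset.sum_mul]
          refine Finset.sum_congr rfl fun i _ => ?_
          rw [norm_smul, RCLike.norm_conj, norm_inv]
          ring
  have h4 : ‖logGrad b c J (z k)‖ ≤ ‖logGrad b c s (z k)‖ + ‖logGrad b c J' (z k)‖ := by
    rw [h2]
    exact norm_le_add_norm_add _ _
  have h5 : κ * ((1 + ‖P (z k)‖) * ‖z k‖⁻¹)⁻¹ ≤ ‖logGrad b c J (z k)‖ * ‖z k‖ := by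
    rw [mul_inv, inv_inv, ← mul_assoc]
    gcongr
    rw [← div_eq_mul_inv, div_le_iff₀ (by positivity)]
    exact h1
  nlinarith

theorem exists_subseq_tendsto_direction {z : ℕ → E}
    (hz : Tendsto (fun k => ‖z k‖) atTop atTop) {S : Submodule ℂ E} (hS : ∀ k, z k ∈ S) :
    ∃ u ∈ S, ‖u‖ = 1 ∧ ∃ φ : ℕ → ℕ, StrictMono φ ∧
      Tendsto (fun k => (‖z (φ k)‖⁻¹ : ℝ) • z (φ k)) atTop (𝓝 u) := by
  have : ProperSpace E := FiniteDimensional.proper ℂ E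
  obtain ⟨u, -, φ, hφ, hu⟩ := (isCompact_closedBall (0 : E) 1).tendsto_subseq
    (x := fun k => (‖z k‖⁻¹ : ℝ) • z k) fun k => by
      rw [mem_closedBall_zero_iff, norm_smul, norm_inv, norm_norm]
      exact inv_mul_le_one
  refine ⟨u, ?_, ?_, φ, hφ, hu⟩
  · refine (Submodule.closed_of_finiteDimensional S).mem_of_tendsto hu (.of_forall fun k => ?_)
    have := S.smul_mem ((‖z (φ k)‖⁻¹ : ℝ) : ℂ) (hS (φ k))
    rwa [Complex.coe_smul] at this
  · refine tendsto_nhds_unique hu.norm (tendsto_const_nhds.congr' ?_)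
    filter_upwards [(hz.comp hφ.tendsto_atTop).eventually_gt_atTop 0] with k hk
    have hk' : ‖z (φ k)‖ ≠ 0 := hk.ne'
    simp only [Function.comp_apply, norm_smul, norm_inv, norm_norm]
    exact (inv_mul_cancel₀ hk').symm

/-- A violating sequence can be projected into the span of the normals. If it accumulates at `y₀`,
pairing the logarithmic gradient with `y - y₀` counts the forms vanishing at `y₀`, which cannot tend
to `0`. If it escapes, its limit direction is not orthogonal to all normals, and the bounds for
proper subsets give a contradiction through `tendsto_norm_logGrad_mul_norm`. -/
theorem logGradBound (s : Finset ι) : LogGradBound b c s := by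
  classical
  have : ProperSpace E := FiniteDimensional.proper ℂ E
  induction s using Finset.strongInduction with
  | H s ih =>
  by_contra hcon
  have hseq (k : ℕ) : ∃ y ∈ normalSpan b s, (∀ i ∈ s, affForm b c i y ≠ 0) ∧
      ‖∏ i ∈ s, affForm b c i y‖ < ((k : ℝ) + 1)⁻¹ ∧
      ‖logGrad b c s y‖ * (1 + ‖y‖) < ((k : ℝ) + 1)⁻¹ := by
    have hk : (0 : ℝ) < ((k : ℝ) + 1)⁻¹ := by positivity
    have h : ¬ ∀ z, (∀ i ∈ s, affForm b c i z ≠ 0) →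
        ‖∏ i ∈ s, affForm b c i z‖ < ((k : ℝ) + 1)⁻¹ →
        ((k : ℝ) + 1)⁻¹ ≤ ‖logGrad b c s z‖ * (1 + ‖z‖) :=
      fun h => hcon ⟨_, hk, _, hk, h⟩
    push Not at h
    obtain ⟨z, h1, h2, h3⟩ := h
    refine ⟨(normalSpan b s).starProjection z, Submodule.starProjection_apply_mem _ _,
      fun i hi => ?_, ?_, ?_⟩
    · rw [affForm_starProjection b c hi]
      exact h1 i hi
    · rwa [Finset.prod_congr rfl fun i hi => affForm_starProjection b c hi z]
    · rw [logGrad_starProjection]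
      refine lt_of_le_of_lt ?_ h3
      gcongr
      exact Submodule.norm_starProjection_apply_le _ _
  choose y hyS hyne hyp hyl using hseq
  have hlim : Tendsto (fun k : ℕ => ((k : ℝ) + 1)⁻¹) atTop (𝓝 0) := by
    simpa [one_div] using tendsto_one_div_add_atTop_nhds_zero_nat (𝕜 := ℝ)
  by_cases hb : ∃ M, ∃ᶠ k in atTop, y k ∈ Metric.closedBall (0 : E) M
  · obtain ⟨M, hM⟩ := hb
    obtain ⟨y₀, -, φ, hφ, hy⟩ := (isCompact_closedBall (0 : E) M).tendsto_subseq' hM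
    have hlim' := hlim.comp hφ.tendsto_atTop
    have hcont (i : ι) : Tendsto (fun k => affForm b c i (y (φ k))) atTop
        (𝓝 (affForm b c i y₀)) := ((continuous_affForm b c i).tendsto y₀).comp hy
    have hprod : ∏ i ∈ s, affForm b c i y₀ = 0 := by
      have h1 := (tendsto_finsetProd s fun i _ => hcont i).norm
      have h2 := le_of_tendsto_of_tendsto' h1 hlim' fun k => (hyp (φ k)).le
      exact norm_le_zero_iff.1 h2
    -- Each form vanishing at `y₀` contributes `ℓ_i(y) / ℓ_i(y) = 1`; the other terms tend to `0`.
    have hsum : Tendsto (fun k => (inner ℂ (logGrad b c s (y (φ k))) (y (φ k) - y₀) : ℂ)) atTop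
        (𝓝 (∑ i ∈ s, if affForm b c i y₀ = 0 then 1 else 0)) := by
      simp only [inner_logGrad, ← affForm_sub_affForm b c]
      refine tendsto_finsetSum _ fun i hi => ?_
      split_ifs with h0
      · refine tendsto_const_nhds.congr fun k => ?_
        rw [h0, sub_zero, inv_mul_cancel₀ (hyne _ i hi)]
      · have := ((hcont i).inv₀ h0).mul ((hcont i).sub_const (affForm b c i y₀))
        simpa using this
    have hzero : Tendsto (fun k => (inner ℂ (logGrad b c s (y (φ k))) (y (φ k) - y₀) : ℂ)) atTop
        (𝓝 0) := by
      have hd : Tendsto (fun k => ‖y (φ k) - y₀‖) atTop (𝓝 0) := by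
        simpa using (hy.sub_const y₀).norm
      refine squeeze_zero_norm (fun k => ?_) hd
      refine (norm_inner_le_norm _ _).trans (mul_le_of_le_one_left (norm_nonneg _) ?_)
      have h1 := hyl (φ k)
      have h2 : ((φ k : ℝ) + 1)⁻¹ ≤ 1 := inv_le_one_of_one_le₀ (by simp)
      nlinarith [norm_nonneg (logGrad b c s (y (φ k))), norm_nonneg (y (φ k))]
    have heq := tendsto_nhds_unique hsum hzero
    rw [Finset.sum_boole, Nat.cast_eq_zero, Finset.card_eq_zero, Finset.filter_eq_empty_iff] at heq
    obtain ⟨i, hi, h0⟩ := Finset.prod_eq_zero_iff.1 hprod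
    exact heq hi h0
  · push Not at hb
    have hy : Tendsto (fun k => ‖y k‖) atTop atTop := by
      refine tendsto_atTop.2 fun M => ?_
      filter_upwards [hb M] with k hk
      simpa using (not_le.1 fun h => hk (by simpa using h)).le
    obtain ⟨u, huS, hu1, φ, hφ, hu⟩ := exists_subseq_tendsto_direction hy hyS
    have hui : ∃ i ∈ s, (inner ℂ (b i) u : ℂ) ≠ 0 := by
      by_contra hall
      push Not at hall
      rw [eq_zero_of_mem_normalSpan b huS hall, norm_zero] at hu1
      exact zero_ne_one hu1
    have h := tendsto_norm_logGrad_mul_norm b c ih (hy.comp hφ.tendsto_atTop) hu hui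
      (fun k => hyne (φ k)) (r := 1) fun k =>
        (hyp (φ k)).le.trans (inv_le_one_of_one_le₀ (by simp))
    obtain ⟨k, hk⟩ := (h.eventually_ge_atTop 1).exists
    have h1 := hyl (φ k)
    have h2 : ((φ k : ℝ) + 1)⁻¹ ≤ 1 := inv_le_one_of_one_le₀ (by simp)
    nlinarith [norm_nonneg (logGrad b c s (y (φ k)))]

/-- Far away in the span of the normals, where the product of the forms is bounded and nonzero, its
logarithmic gradient is not radial. -/
theorem exists_radius_logGrad_not_radial (s : Finset ι) (r : ℝ) :
    ∃ R₀ > 0, ∀ z ∈ normalSpan b s, R₀ ≤ ‖z‖ → (∀ i ∈ s, affForm b c i z ≠ 0) →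
      ‖∏ i ∈ s, affForm b c i z‖ ≤ r → ∀ a : ℂ, logGrad b c s z ≠ a • z := by
  by_contra hcon
  have hseq (k : ℕ) : ∃ z ∈ normalSpan b s, (k : ℝ) + 1 ≤ ‖z‖ ∧ (∀ i ∈ s, affForm b c i z ≠ 0) ∧
      ‖∏ i ∈ s, affForm b c i z‖ ≤ r ∧ ∃ a : ℂ, logGrad b c s z = a • z := by
    by_contra h
    push Not at h
    exact hcon ⟨(k : ℝ) + 1, by positivity, h⟩
  choose z hzS hzk hzne hzr a ha using hseq
  have hz : Tendsto (fun k => ‖z k‖) atTop atTop :=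
    tendsto_atTop_mono (fun k => (le_add_of_nonneg_right zero_le_one).trans (hzk k))
      tendsto_natCast_atTop_atTop
  obtain ⟨u, huS, hu1, φ, hφ, hu⟩ := exists_subseq_tendsto_direction hz hzS
  have hz' := hz.comp hφ.tendsto_atTop
  have hui : ∃ i ∈ s, (inner ℂ (b i) u : ℂ) ≠ 0 := by
    by_contra hall
    push Not at hall
    rw [eq_zero_of_mem_normalSpan b huS hall, norm_zero] at hu1
    exact zero_ne_one hu1
  have hbig := tendsto_norm_logGrad_mul_norm b c (fun J _ => logGradBound b c J) hz' hu hui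
    (fun k => hzne (φ k)) fun k => hzr (φ k)
  have hcos : Tendsto (fun k => ‖(inner ℂ ((‖z (φ k)‖⁻¹ : ℝ) • z (φ k)) u : ℂ)‖) atTop (𝓝 1) := by
    have h1 : Tendsto (fun k => ‖(inner ℂ ((‖z (φ k)‖⁻¹ : ℝ) • z (φ k)) u : ℂ)‖) atTop
        (𝓝 ‖(inner ℂ u u : ℂ)‖) := (hu.inner tendsto_const_nhds).norm
    rwa [inner_self_eq_norm_sq_to_K, hu1, RCLike.ofReal_one, one_pow, norm_one] at h1
  -- These sums bound `‖z‖ |⟨logGrad, u⟩|`, as the forms with `⟨b_i, u⟩ = 0` drop out. For a radial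
  -- logarithmic gradient the same quantity is `‖logGrad‖ ‖z‖` times a factor tending to `1`, hence
  -- unbounded.
  have hbd : Tendsto (fun k => ∑ i ∈ s, ‖(inner ℂ (b i) u : ℂ)‖ *
      (‖z (φ k)‖ * ‖affForm b c i (z (φ k))‖⁻¹)) atTop
      (𝓝 (∑ i ∈ s, ‖(inner ℂ (b i) u : ℂ)‖ * ‖(inner ℂ (b i) u : ℂ)‖⁻¹)) := by
    refine tendsto_finsetSum _ fun i _ => ?_
    by_cases h0 : (inner ℂ (b i) u : ℂ) = 0
    · simp [h0]
    · exact (tendsto_norm_div_affForm b c hz' hu h0).const_mul _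
  refine not_tendsto_atTop_of_tendsto_nhds hbd
    (tendsto_atTop_mono' _ ?_ (hbig.atTop_mul_pos one_pos hcos))
  filter_upwards [hz'.eventually_gt_atTop 0] with k hk
  have hk' : 0 < ‖z (φ k)‖ := hk
  have h1 : ‖(inner ℂ (logGrad b c s (z (φ k))) u : ℂ)‖ * ‖z (φ k)‖ ≤
      ∑ i ∈ s, ‖(inner ℂ (b i) u : ℂ)‖ * (‖z (φ k)‖ * ‖affForm b c i (z (φ k))‖⁻¹) := by
    rw [inner_logGrad]
    refine (mul_le_mul_of_nonneg_right (norm_sum_le _ _) hk'.le).trans_eq ?_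
    rw [Finset.sum_mul]
    refine Finset.sum_congr rfl fun i _ => ?_
    rw [norm_mul, norm_inv]
    ring
  refine le_trans (le_of_eq ?_) h1
  rw [ha, inner_smul_left, norm_mul, RCLike.norm_conj, norm_smul]
  have h2 : (inner ℂ ((‖z (φ k)‖⁻¹ : ℝ) • z (φ k)) u : ℂ) =
      (‖z (φ k)‖⁻¹ : ℝ) • (inner ℂ (z (φ k)) u : ℂ) := by
    rw [← Complex.coe_smul, inner_smul_left, Complex.conj_ofReal, Complex.real_smul]
  rw [h2, norm_smul, norm_inv, norm_norm]
  field_simp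

end AffineForms

/-! ### Products of affine forms: gradients, outward fields, regular values. -/

noncomputable section AffineProduct

open scoped Topology ComplexConjugate

universe u

variable {E : Type u} [NormedAddCommGroup E] [InnerProductSpace ℂ E]
variable {ι : Type*} (b : ι → E) (c : ι → ℂ)

/-- The product of the affine forms indexed by `s`. -/
def affProd (s : Finset ι) (z : E) : ℂ := ∏ i ∈ s, affForm b c i z

theorem hasFDerivAt_affForm (i : ι) (z : E) :
    HasFDerivAt (affForm b c i) (innerSL ℂ (b i)) z :=
  (innerSL ℂ (b i)).hasFDerivAt.add_const (c i)

theorem contDiff_affForm (i : ι) : ContDiff ℝ ∞ (affForm b c i) :=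
  ((innerSL ℂ (b i)).restrictScalars ℝ).contDiff.add contDiff_const

theorem contDiff_affProd (s : Finset ι) : ContDiff ℝ ∞ (affProd b c s) :=
  contDiff_prod fun i _ => contDiff_affForm b c i

theorem affProd_ne_zero_iff {s : Finset ι} {z : E} :
    affProd b c s z ≠ 0 ↔ ∀ i ∈ s, affForm b c i z ≠ 0 :=
  Finset.prod_ne_zero_iff

variable [DecidableEq ι]

/-- The vector representing the derivative of `affProd`. -/
def affProdGrad (s : Finset ι) (z : E) : E :=
  ∑ i ∈ s, conj (∏ j ∈ s.erase i, affForm b c j z) • b i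

theorem inner_affProdGrad (s : Finset ι) (z w : E) :
    inner ℂ (affProdGrad b c s z) w =
      ∑ i ∈ s, (∏ j ∈ s.erase i, affForm b c j z) * inner ℂ (b i) w := by
  simp [affProdGrad, mul_comm, -map_prod]

theorem hasFDerivAt_affProd (s : Finset ι) (z : E) :
    HasFDerivAt (affProd b c s) (innerSL ℂ (affProdGrad b c s z)) z := by
  have h := HasFDerivAt.finsetProd (u := s) fun i _ => hasFDerivAt_affForm b c i z
  refine h.congr_fderiv ?_
  ext w
  rw [innerSL_apply_apply, inner_affProdGrad]
  simp

theorem contDiff_affProdGrad (s : Finset ι) : ContDiff ℝ ∞ (affProdGrad b c s) := by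
  refine ContDiff.sum fun i _ => ContDiff.smul ?_ contDiff_const
  exact Complex.conjCLE.contDiff.comp (contDiff_prod fun j _ => contDiff_affForm b c j)

theorem affProdGrad_eq_smul_logGrad {s : Finset ι} {z : E} (h : affProd b c s z ≠ 0) :
    affProdGrad b c s z = conj (affProd b c s z) • logGrad b c s z := by
  rw [affProdGrad, logGrad, Finset.smul_sum]
  refine Finset.sum_congr rfl fun i hi => ?_
  rw [smul_smul, ← map_mul]
  congr 2
  rw [affProd, ← Finset.mul_prod_erase s _ hi, mul_comm, inv_mul_cancel_left₀]
  exact (affProd_ne_zero_iff b c).1 h i hi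

theorem inner_affProdGrad_of_orthogonal {s : Finset ι} {w : E}
    (h : ∀ i ∈ s, (inner ℂ (b i) w : ℂ) = 0) (z : E) :
    (inner ℂ (affProdGrad b c s z) w : ℂ) = 0 := by
  rw [inner_affProdGrad]
  exact Finset.sum_eq_zero fun i hi => by rw [h i hi, mul_zero]

/-- Euler's identity for a product of affine forms vanishing at `z`. -/
theorem inner_affProdGrad_sub {s : Finset ι} {z : E} (h : ∀ i ∈ s, affForm b c i z = 0) (y : E) :
    (inner ℂ (affProdGrad b c s y) (y - z) : ℂ) = s.card * affProd b c s y := by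
  rw [inner_affProdGrad, ← nsmul_eq_mul, ← Finset.sum_const]
  refine Finset.sum_congr rfl fun i hi => ?_
  rw [← affForm_sub_affForm b c, h i hi, sub_zero, mul_comm]
  exact Finset.mul_prod_erase s (fun j => affForm b c j y) hi

/-- The Leibniz rule for a splitting of the product in two, read off from uniqueness of the
derivative. -/
theorem inner_affProdGrad_filter (s : Finset ι) (p : ι → Prop) [DecidablePred p] (z w : E) :
    (inner ℂ (affProdGrad b c s z) w : ℂ) =
      affProd b c (s.filter p) z * inner ℂ (affProdGrad b c (s.filter fun i => ¬ p i) z) w +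
      affProd b c (s.filter fun i => ¬ p i) z * inner ℂ (affProdGrad b c (s.filter p) z) w := by
  have h1 := hasFDerivAt_affProd b c s z
  have h2 := (hasFDerivAt_affProd b c (s.filter p) z).mul
    (hasFDerivAt_affProd b c (s.filter fun i => ¬ p i) z)
  have h3 : affProd b c s = affProd b c (s.filter p) * affProd b c (s.filter fun i => ¬ p i) := by
    ext y
    exact (Finset.prod_filter_mul_prod_filter_not s p _).symm
  rw [h3] at h1
  have h4 := congrArg (fun L : E →L[ℂ] ℂ => L w) (h1.unique h2)
  simpa using h4

/-- Near a zero of the product which is not the point closest to the origin of its flat, there is a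
field tangent to the levels of the product which points outwards. -/
theorem exists_local_field_of_zero [FiniteDimensional ℂ E] {s : Finset ι} {z : E}
    (h0 : affProd b c s z = 0) (hz : z ∉ normalSpan b (s.filter fun i => affForm b c i z = 0)) :
    ∃ U ∈ 𝓝 z, ∃ w : E → E, ContDiffOn ℝ ∞ w U ∧
      ∀ y ∈ U, inner ℂ (affProdGrad b c s y) (w y) = 0 ∧ 0 < (inner ℂ y (w y)).re := by
  set J := s.filter fun i => affForm b c i z = 0 with hJ
  set J' := s.filter fun i => ¬ affForm b c i z = 0 with hJ'
  have hJz : ∀ i ∈ J, affForm b c i z = 0 := fun i hi => (Finset.mem_filter.1 hi).2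
  have hJc : (J.card : ℂ) ≠ 0 := by
    obtain ⟨i, hi, hi0⟩ := Finset.prod_eq_zero_iff.1 h0
    exact_mod_cast Finset.card_ne_zero_of_mem (Finset.mem_filter.2 ⟨hi, hi0⟩)
  have hJ'z : affProd b c J' z ≠ 0 :=
    (affProd_ne_zero_iff b c).2 fun i hi => (Finset.mem_filter.1 hi).2
  set P := (normalSpan b J).starProjection with hP
  set v := z - P z with hv
  have hv0 : v ≠ 0 := fun h => hz (by
    rw [sub_eq_zero.1 h]
    exact Submodule.starProjection_apply_mem _ _)
  have hvo : v ∈ (normalSpan b J)ᗮ := Submodule.sub_starProjection_mem_orthogonal z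
  have hvJ : ∀ i ∈ J, (inner ℂ (b i) v : ℂ) = 0 := fun i hi =>
    hvo _ (Submodule.subset_span (mem_image_of_mem b hi))
  have hzv : (inner ℂ z v : ℂ) = (‖v‖ ^ 2 : ℝ) := by
    have h1 : z = v + P z := by simp [hv]
    conv_lhs => rw [h1]
    rw [inner_add_left, hvo _ (Submodule.starProjection_apply_mem _ z), add_zero,
      inner_self_eq_norm_sq_to_K]
    push_cast
    rfl
  -- Write `f = f_J f_{J'}`. By Euler's identity, `df(y - z) = f_J D`, while `df(v) = f_J
  -- df_{J'}(v)` since `v` is orthogonal to the normals of `J`. Both share the factor `f_J`, so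
  -- subtracting `(df_{J'}(v) / D) (y - z)` from `v` gives a field killed by `df`, equal to `v` at
  -- `z`.
  set D : E → ℂ := fun y => J.card * affProd b c J' y +
    inner ℂ (affProdGrad b c J' y) (y - z) with hD
  have hDs : ContDiff ℝ ∞ D := by
    refine (contDiff_const.mul (contDiff_affProd b c J')).add ?_
    exact (contDiff_affProdGrad b c J').inner ℂ (contDiff_id.sub contDiff_const)
  have hDz : D z ≠ 0 := by
    simp only [hD, sub_self, inner_zero_right, add_zero]
    exact mul_ne_zero hJc hJ'z
  set w : E → E := fun y => v - (inner ℂ (affProdGrad b c J' y) v * (D y)⁻¹) • (y - z) with hw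
  have hU1 : IsOpen {y | D y ≠ 0} := isOpen_ne_fun hDs.continuous continuous_const
  have hws : ContDiffOn ℝ ∞ w {y | D y ≠ 0} := by
    have h1 : ContDiffOn ℝ ∞ (fun y => inner ℂ (affProdGrad b c J' y) v) {y | D y ≠ 0} :=
      ((contDiff_affProdGrad b c J').inner ℂ contDiff_const).contDiffOn
    have h2 : ContDiffOn ℝ ∞ (fun y => (D y)⁻¹) {y | D y ≠ 0} :=
      hDs.contDiffOn.inv fun y hy => hy
    exact contDiffOn_const.sub ((h1.mul h2).smul (contDiffOn_id.sub contDiffOn_const))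
  have hre : ContinuousOn (fun y => (inner ℂ y (w y)).re) {y | D y ≠ 0} :=
    Complex.continuous_re.comp_continuousOn (continuousOn_id.inner hws.continuousOn)
  refine ⟨_, (hre.isOpen_inter_preimage hU1 isOpen_Ioi).mem_nhds (x := z) (s := _ ∩ _ ⁻¹' Ioi 0)
    ⟨hDz, ?_⟩, w, hws.mono inter_subset_left, fun y hy => ⟨?_, hy.2⟩⟩
  · rw [mem_preimage, mem_Ioi, hw]
    simp only [sub_self, smul_zero, sub_zero]
    rw [hzv, Complex.ofReal_re]
    have := norm_pos_iff.2 hv0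
    positivity
  · have hDy : D y ≠ 0 := hy.1
    rw [inner_affProdGrad_filter b c s (fun i => affForm b c i z = 0), hw]
    simp only [inner_sub_right (𝕜 := ℂ) _ v, inner_smul_right]
    rw [inner_affProdGrad_of_orthogonal b c hvJ, inner_affProdGrad_sub b c hJz]
    have hDe : D y = J.card * affProd b c J' y + inner ℂ (affProdGrad b c J' y) (y - z) := rfl
    have h1 : (inner ℂ (affProdGrad b c J' y) (y - z) : ℂ) =
        D y - J.card * affProd b c J' y := by rw [hDe]; ring
    rw [h1]
    field_simp
    ring

/-- Where the gradient is not radial, there is a field tangent to the levels of the product which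
points outwards. -/
theorem exists_local_field_of_not_radial {G : E → E} (hG : ContDiff ℝ ∞ G) {z : E} (hz : z ≠ 0)
    (h : ∀ a : ℂ, G z ≠ a • z) :
    ∃ U ∈ 𝓝 z, ∃ w : E → E, ContDiffOn ℝ ∞ w U ∧
      ∀ y ∈ U, inner ℂ (G y) (w y) = 0 ∧ 0 < (inner ℂ y (w y)).re := by
  have hGz : G z ≠ 0 := fun h0 => h 0 (by rw [h0, zero_smul])
  -- The component of `y` orthogonal to `G y`. It satisfies `⟨y, q⟩ = ‖q‖ ^ 2`, and `q z = 0` would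
  -- make `z` a multiple of `G z`.
  set q : E → E := fun y => y - (inner ℂ (G y) y * ((‖G y‖ ^ 2 : ℝ) : ℂ)⁻¹) • G y with hq
  have hU1 : IsOpen {y | G y ≠ 0} := isOpen_ne_fun hG.continuous continuous_const
  have hqs : ContDiffOn ℝ ∞ q {y | G y ≠ 0} := by
    have h1 : ContDiffOn ℝ ∞ (fun y => inner ℂ (G y) y) {y | G y ≠ 0} :=
      (hG.inner ℂ contDiff_id).contDiffOn
    have h2 : ContDiffOn ℝ ∞ (fun y => ((‖G y‖ ^ 2 : ℝ) : ℂ)⁻¹) {y | G y ≠ 0} := by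
      refine ContDiffOn.inv ?_ fun y hy => ?_
      · exact (Complex.ofRealCLM.contDiff.comp (hG.norm_sq ℂ)).contDiffOn
      · have : G y ≠ 0 := hy
        simpa using this
    exact contDiffOn_id.sub ((h1.mul h2).smul hG.contDiffOn)
  have hqz : q z ≠ 0 := by
    intro h0
    set a := inner ℂ (G z) z * ((‖G z‖ ^ 2 : ℝ) : ℂ)⁻¹ with ha
    have h1 : z = a • G z := sub_eq_zero.1 h0
    have ha0 : a ≠ 0 := by
      intro ha0
      rw [ha0, zero_smul] at h1
      exact hz h1
    refine h a⁻¹ ?_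
    conv_rhs => rw [h1]
    rw [smul_smul, inv_mul_cancel₀ ha0, one_smul]
  have horth (y : E) (hy : G y ≠ 0) : (inner ℂ (G y) (q y) : ℂ) = 0 := by
    have : (‖G y‖ : ℂ) ≠ 0 := by simpa using hy
    rw [hq]
    simp only [inner_sub_right, inner_smul_right, inner_self_eq_norm_sq_to_K]
    push_cast
    field_simp
    simp
  refine ⟨_, (hqs.continuousOn.isOpen_inter_preimage hU1 isOpen_compl_singleton).mem_nhds
    (x := z) (s := _ ∩ _ ⁻¹' {0}ᶜ) ⟨hGz, hqz⟩, q, hqs.mono inter_subset_left,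
    fun y hy => ⟨horth y hy.1, ?_⟩⟩
  have hqy : q y ≠ 0 := hy.2
  have h1 : y = q y + (inner ℂ (G y) y * ((‖G y‖ ^ 2 : ℝ) : ℂ)⁻¹) • G y := by simp [hq]
  have h2 : (inner ℂ y (q y) : ℂ) = (‖q y‖ ^ 2 : ℝ) := by
    have h3 : (inner ℂ y (q y) : ℂ) =
        inner ℂ (q y + (inner ℂ (G y) y * ((‖G y‖ ^ 2 : ℝ) : ℂ)⁻¹) • G y) (q y) := by rw [← h1]
    rw [h3, inner_add_left, inner_smul_left, horth y hy.1, mul_zero, add_zero,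
      inner_self_eq_norm_sq_to_K]
    push_cast
    rfl
  rw [h2, Complex.ofReal_re]
  have := norm_pos_iff.2 hqy
  positivity

variable [FiniteDimensional ℂ E]

/-- Off the span of the normals, the component orthogonal to this span points outwards and is
tangent to the levels of the product. -/
theorem exists_local_field_of_notMem_normalSpan {s : Finset ι} {z : E}
    (hz : z ∉ normalSpan b s) :
    ∃ U ∈ 𝓝 z, ∃ w : E → E, ContDiffOn ℝ ∞ w U ∧
      ∀ y ∈ U, inner ℂ (affProdGrad b c s y) (w y) = 0 ∧ 0 < (inner ℂ y (w y)).re := by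
  set P := (normalSpan b s).starProjection with hP
  have hws : ContDiff ℝ ∞ fun y => y - P y := contDiff_id.sub (P.restrictScalars ℝ).contDiff
  have hU : IsOpen {y | y - P y ≠ 0} := isOpen_ne_fun hws.continuous continuous_const
  refine ⟨_, hU.mem_nhds ?_, fun y => y - P y, hws.contDiffOn, fun y hy => ⟨?_, ?_⟩⟩
  · intro h
    apply hz
    rw [sub_eq_zero.1 h]
    exact Submodule.starProjection_apply_mem _ _
  · refine inner_affProdGrad_of_orthogonal b c (fun i hi => ?_) y
    exact Submodule.sub_starProjection_mem_orthogonal (K := normalSpan b s) y _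
      (Submodule.subset_span (mem_image_of_mem b hi))
  · have hvo := Submodule.sub_starProjection_mem_orthogonal (K := normalSpan b s) y
    have h1 : (inner ℂ y (y - P y) : ℂ) = (‖y - P y‖ ^ 2 : ℝ) := by
      have h2 : (inner ℂ (P y) (y - P y) : ℂ) = 0 :=
        hvo _ (Submodule.starProjection_apply_mem _ y)
      have h3 : (inner ℂ y (y - P y) : ℂ) = inner ℂ (y - P y) (y - P y) := by
        rw [inner_sub_left, h2, sub_zero]
      rw [h3, inner_self_eq_norm_sq_to_K]
      push_cast
      rfl
    rw [h1, Complex.ofReal_re]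
    have := norm_pos_iff.2 (show y - P y ≠ 0 from hy)
    positivity

/-- Off the zeros, the gradient and the logarithmic gradient differ by a nonzero scalar, so they are
radial at the same points. -/
theorem exists_radius_affProdGrad_not_radial (s : Finset ι) (r : ℝ) :
    ∃ R₀ > 0, ∀ z ∈ normalSpan b s, R₀ ≤ ‖z‖ → affProd b c s z ≠ 0 → ‖affProd b c s z‖ ≤ r →
      ∀ a : ℂ, affProdGrad b c s z ≠ a • z := by
  obtain ⟨R₀, hR₀, h⟩ := exists_radius_logGrad_not_radial b c s r
  refine ⟨R₀, hR₀, fun z hz hzR hz0 hzr a ha => ?_⟩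
  refine h z hz hzR ((affProd_ne_zero_iff b c).1 hz0) hzr ((conj (affProd b c s z))⁻¹ * a) ?_
  rw [mul_smul, ← ha, affProdGrad_eq_smul_logGrad b c hz0, smul_smul, inv_mul_cancel₀, one_smul]
  exact (map_ne_zero _).2 hz0

variable [Fintype ι]

/-- An outward field is found near each far point of the tube by one of three means: at zeros by the
Euler correction, at nonzero values in the span of the normals by non-radiality, and off that span
by the orthogonal component. The last case is what allows arrangements that are not essential. -/
theorem exists_diffeo_tube_affProd (r : ℝ) :
    ∃ R₀ : ℝ, 0 < R₀ ∧ ∀ R : ℝ, R₀ ≤ R → ∃ Φ : E → E,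
      IsDiffeoBetween Φ (Metric.ball 0 R ∩ affProd b c Finset.univ ⁻¹' Metric.closedBall 0 r)
        (affProd b c Finset.univ ⁻¹' Metric.closedBall 0 r) ∧
      ∀ z ∈ Metric.ball 0 R ∩ affProd b c Finset.univ ⁻¹' Metric.closedBall 0 r,
        affProd b c Finset.univ (Φ z) = affProd b c Finset.univ z := by
  obtain ⟨R₁, hR₁, h1⟩ := exists_radius_affProdGrad_not_radial b c Finset.univ r
  obtain ⟨R₂, -, h2⟩ := exists_radius_notMem_normalSpan b c
  refine ⟨max R₁ R₂ + 2, by positivity, fun R hR =>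
    exists_diffeo_tube_of_local_fields (hasFDerivAt_affProd b c Finset.univ)
      (lt_max_of_lt_left hR₁) (fun z hz hzr => ?_) hR⟩
  by_cases h0 : affProd b c Finset.univ z = 0
  · exact exists_local_field_of_zero b c h0
      (h2 _ z ((le_max_right _ _).trans hz) fun i hi => (Finset.mem_filter.1 hi).2)
  · by_cases hzs : z ∈ normalSpan b Finset.univ
    · refine exists_local_field_of_not_radial (contDiff_affProdGrad b c Finset.univ) ?_
        (h1 z hzs ((le_max_left _ _).trans hz) h0 hzr)
      rintro rfl
      rw [norm_zero] at hz
      linarith [le_max_left R₁ R₂]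
    · exact exists_local_field_of_notMem_normalSpan b c hzs

/-- A nonzero value of a product of affine forms whose normals span is regular at infinity. -/
theorem affProd_fibration_of_ne_zero (hspan : normalSpan b Finset.univ = ⊤) {t : ℂ} (ht : t ≠ 0) :
    ∃ δ : ℝ, 0 < δ ∧ ∃ R₀ : ℝ, 0 < R₀ ∧ ∀ R : ℝ, R₀ ≤ R →
      IsLocallyTrivialFibration (affProd b c Finset.univ)
        (affProd b c Finset.univ ⁻¹' Metric.closedBall t δ \ Metric.closedBall 0 R)
        (Metric.closedBall t δ) := by
  have ht' : 0 < ‖t‖ := norm_pos_iff.2 ht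
  obtain ⟨R₁, hR₁, h1⟩ := exists_radius_affProdGrad_not_radial b c Finset.univ (2 * ‖t‖)
  -- On the disk of radius `3 δ = ‖t‖ / 2` about `t`, values are nonzero and of norm below `2 ‖t‖`.
  refine ⟨‖t‖ / 6, by positivity, R₁, hR₁, fun R hR =>
    isLocallyTrivialFibration_of_gradient_not_radial (contDiff_affProdGrad b c _)
      (hasFDerivAt_affProd b c _) (contDiff_affProd b c _) (by positivity) hR₁
      (fun z hz hzt => ?_) hR⟩
  refine h1 z (hspan ▸ Submodule.mem_top) hz ?_ ?_
  · intro h0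
    rw [h0, zero_sub, norm_neg] at hzt
    linarith
  · have := norm_le_norm_add_norm_sub' (affProd b c Finset.univ z) t
    linarith

/-- If the normals span, and so do those of any two forms with a common zero, then `0` is regular at
infinity for the product of the forms. -/
theorem affProd_fibration_zero (hspan : normalSpan b Finset.univ = ⊤) (hb : ∀ i, b i ≠ 0)
    (hpair : ∀ i j, i ≠ j → ∀ z, affForm b c i z = 0 → affForm b c j z = 0 →
      ∀ J : Finset ι, i ∈ J → j ∈ J → normalSpan b J = ⊤) :
    ∃ δ : ℝ, 0 < δ ∧ ∃ R₀ : ℝ, 0 < R₀ ∧ ∀ R : ℝ, R₀ ≤ R →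
      IsLocallyTrivialFibration (affProd b c Finset.univ)
        (affProd b c Finset.univ ⁻¹' Metric.closedBall 0 δ \ Metric.closedBall 0 R)
        (Metric.closedBall 0 δ) := by
  obtain ⟨R₁, hR₁, h1⟩ := exists_radius_affProdGrad_not_radial b c Finset.univ 3
  obtain ⟨R₂, -, h2⟩ := exists_radius_notMem_normalSpan b c
  refine ⟨1, one_pos, max R₁ R₂, lt_max_of_lt_left hR₁, fun R hR =>
    isLocallyTrivialFibration_of_gradient_not_radial (contDiff_affProdGrad b c _)
      (hasFDerivAt_affProd b c _) (contDiff_affProd b c _) one_pos (lt_max_of_lt_left hR₁)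
      (fun z hz hzt a ha => ?_) hR⟩
  by_cases h0 : affProd b c Finset.univ z = 0
  · obtain ⟨i, -, hi⟩ := Finset.prod_eq_zero_iff.1 h0
    have hJ := h2 (Finset.univ.filter fun i => affForm b c i z = 0) z ((le_max_right _ _).trans hz)
      fun i hi => (Finset.mem_filter.1 hi).2
    -- Two vanishing forms would make the span of the normals of the forms vanishing at `z`
    -- everything, whereas far out it misses `z`.
    have huniq (j : ι) (hj : affForm b c j z = 0) : j = i := by
      by_contra hji
      refine hJ ?_
      rw [hpair j i hji z hj hi _ (by simpa using hj) (by simpa using hi)]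
      exact Submodule.mem_top
    have hG : affProdGrad b c Finset.univ z =
        conj (∏ j ∈ Finset.univ.erase i, affForm b c j z) • b i := by
      refine Finset.sum_eq_single i (fun j _ hji => ?_) (by simp)
      rw [Finset.prod_eq_zero (Finset.mem_erase.2 ⟨hji.symm, Finset.mem_univ i⟩) hi, map_zero,
        zero_smul]
    have hcoef : conj (∏ j ∈ Finset.univ.erase i, affForm b c j z) ≠ 0 := by
      refine (map_ne_zero _).2 (Finset.prod_ne_zero_iff.2 fun j hj hj0 => ?_)
      exact (Finset.mem_erase.1 hj).1 (huniq j hj0)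
    rw [hG] at ha
    have ha0 : a ≠ 0 := by
      rintro rfl
      rw [zero_smul] at ha
      exact smul_ne_zero hcoef (hb i) ha
    -- A radial gradient would put `z` on the line through `b i`, inside the span it must avoid.
    refine hJ ?_
    have hz' : z = a⁻¹ • conj (∏ j ∈ Finset.univ.erase i, affForm b c j z) • b i := by
      rw [ha, smul_smul, inv_mul_cancel₀ ha0, one_smul]
    rw [hz']
    refine Submodule.smul_mem _ _ (Submodule.smul_mem _ _ ?_)
    rw [← hz']
    exact Submodule.subset_span (mem_image_of_mem b (by simpa using hi))
  · refine h1 z (hspan ▸ Submodule.mem_top) ((le_max_left _ _).trans hz) h0 ?_ a ha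
    simpa using hzt

end AffineProduct

/-! ### Translation to hyperplane arrangements and the planar case. -/

namespace HyperplaneArrangement

open scoped ComplexConjugate

variable {n d : ℕ} (A : HyperplaneArrangement n d)

/-- The normal vector of the `i`-th hyperplane for the Hermitian inner product. -/
noncomputable def normal (i : Fin d) : EuclideanSpace ℂ (Fin n) :=
  WithLp.toLp 2 fun j => conj (A.a i j)

theorem inner_normal (i : Fin d) (z : EuclideanSpace ℂ (Fin n)) :
    inner ℂ (A.normal i) z = ∑ j, A.a i j * z j := by
  rw [PiLp.inner_apply]
  refine Finset.sum_congr rfl fun j _ => ?_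
  simp [normal, mul_comm]

theorem affForm_normal (i : Fin d) (z : EuclideanSpace ℂ (Fin n)) :
    affForm A.normal A.c i z = ∑ j, A.a i j * z j + A.c i := by
  rw [affForm, inner_normal]

theorem polyMap_defPoly : polyMap A.defPoly = affProd A.normal A.c Finset.univ := by
  ext z
  simp [polyMap, defPoly, form, affProd, affForm_normal, map_prod]

theorem normal_ne_zero (i : Fin d) : A.normal i ≠ 0 := by
  intro h
  refine A.a_ne_zero i (funext fun j => ?_)
  have := congrArg (fun v : EuclideanSpace ℂ (Fin n) => v j) h
  simpa [normal] using this

theorem normalSpan_eq_top {J : Finset (Fin d)}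
    (h : ∀ z : EuclideanSpace ℂ (Fin n), (∀ i ∈ J, ∑ j, A.a i j * z j = 0) → z = 0) :
    normalSpan A.normal J = ⊤ := by
  rw [← Submodule.orthogonal_eq_bot_iff, Submodule.eq_bot_iff]
  intro z hz
  refine h z fun i hi => ?_
  rw [← inner_normal]
  exact hz _ (Submodule.subset_span (mem_image_of_mem _ hi))

theorem IsEssential.normalSpan_univ {A : HyperplaneArrangement n d} (hA : A.IsEssential) :
    normalSpan A.normal Finset.univ = ⊤ := by
  refine A.normalSpan_eq_top fun z hz => ?_
  have h (v : Fin n → ℂ) : ∑ j, v j * z j = 0 := by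
    have hv : v ∈ Submodule.span ℂ (range A.a) := by
      rw [hA]
      exact Submodule.mem_top
    induction hv using Submodule.span_induction with
    | mem x hx =>
      obtain ⟨i, rfl⟩ := hx
      exact hz i (Finset.mem_univ i)
    | zero => simp
    | add x y _ _ hx hy => simp [add_mul, Finset.sum_add_distrib, hx, hy]
    | smul a x _ hx => simp [mul_assoc, ← Finset.mul_sum, hx]
  ext j
  simpa [Pi.single_apply] using h (Pi.single j 1)

theorem exists_smul_eq_of_det_eq_zero {v w : Fin 2 → ℂ} (hv : v ≠ 0)
    (h : v 0 * w 1 - v 1 * w 0 = 0) : ∃ u : ℂ, w = u • v := by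
  by_cases h0 : v 0 = 0
  · have h1 : v 1 ≠ 0 := fun h1 => hv (funext fun k => by fin_cases k <;> simp [h0, h1])
    refine ⟨w 1 / v 1, funext fun k => ?_⟩
    fin_cases k
    · have : w 0 = 0 := by simpa [h0, h1] using h
      simp [h0, this]
    · simp [h1]
  · refine ⟨w 0 / v 0, funext fun k => ?_⟩
    fin_cases k
    · simp [h0]
    · simp only [Fin.mk_one, Pi.smul_apply, smul_eq_mul]
      field_simp
      linear_combination h

theorem eq_zero_of_det_ne_zero {v w : Fin 2 → ℂ} (h : v 0 * w 1 - v 1 * w 0 ≠ 0)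
    {z : EuclideanSpace ℂ (Fin 2)} (hv : ∑ j, v j * z j = 0) (hw : ∑ j, w j * z j = 0) :
    z = 0 := by
  rw [Fin.sum_univ_two] at hv hw
  have h0 : (v 0 * w 1 - v 1 * w 0) * z 0 = 0 := by linear_combination w 1 * hv - v 1 * hw
  have h1 : (v 0 * w 1 - v 1 * w 0) * z 1 = 0 := by linear_combination v 0 * hw - w 0 * hv
  ext k
  fin_cases k
  · simpa using (mul_eq_zero.1 h0).resolve_left h
  · simpa using (mul_eq_zero.1 h1).resolve_left h

/-- Two distinct lines of an arrangement in the plane which meet have independent equations. -/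
theorem det_ne_zero_of_meet {A : HyperplaneArrangement 2 d} {i j : Fin d} (hij : i ≠ j)
    {z : EuclideanSpace ℂ (Fin 2)} (hi : affForm A.normal A.c i z = 0)
    (hj : affForm A.normal A.c j z = 0) : A.a i 0 * A.a j 1 - A.a i 1 * A.a j 0 ≠ 0 := by
  intro h
  obtain ⟨u, hu⟩ := exists_smul_eq_of_det_eq_zero (A.a_ne_zero i) h
  have hu0 : u ≠ 0 := by
    rintro rfl
    exact A.a_ne_zero j (by rw [hu, zero_smul])
  have hsum (x : Fin 2 → ℂ) : ∑ k, A.a j k * x k = u * ∑ k, A.a i k * x k := by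
    simp only [hu, Pi.smul_apply, smul_eq_mul, Finset.mul_sum, mul_assoc]
  rw [affForm_normal] at hi hj
  -- The common zero forces the constants to be proportional too, so the two lines would coincide.
  have hc : A.c j = u * A.c i := by
    have := hsum fun k => z k
    linear_combination hj - u * hi - this
  refine hij (A.distinct (Set.ext fun x => ?_))
  simp only [mem_ofPred_eq]
  rw [hsum, hc, ← mul_add, mul_eq_zero, or_iff_right hu0]

end HyperplaneArrangement

theorem lemma4p3 :
    (∀ (n d : ℕ) (A : HyperplaneArrangement n d) (r : ℝ), 0 < r →
      ∃ R₀ : ℝ, 0 < R₀ ∧ ∀ R : ℝ, R₀ ≤ R →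
        ∃ Φ : EuclideanSpace ℂ (Fin n) → EuclideanSpace ℂ (Fin n),
          IsDiffeoBetween Φ (Metric.ball 0 R ∩ tube A.defPoly r) (tube A.defPoly r) ∧
          ∀ z ∈ Metric.ball 0 R ∩ tube A.defPoly r,
            polyMap A.defPoly (Φ z) = polyMap A.defPoly z) ∧
    (∀ (n d : ℕ) (A : HyperplaneArrangement n d), A.IsEssential →
      irregularValuesAtInfinity A.defPoly ⊆ {0}) ∧
    (∀ (d : ℕ) (A : HyperplaneArrangement 2 d), ¬ A.AllParallel →
      irregularValuesAtInfinity A.defPoly = ∅) := by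
  refine ⟨fun n d A r _ => ?_, fun n d A hA t ht => ?_, fun d A hA => ?_⟩
  · unfold tube
    rw [A.polyMap_defPoly]
    exact exists_diffeo_tube_affProd A.normal A.c r
  · by_contra ht0
    refine ht ?_
    unfold IsRegularValueAtInfinity
    rw [A.polyMap_defPoly]
    exact affProd_fibration_of_ne_zero A.normal A.c hA.normalSpan_univ ht0
  -- Used twice: for a non-parallel pair, which shows that the normals span, and for each pair of
  -- lines that meet, as the value `0` requires.
  · have htop : ∀ i j, A.a i 0 * A.a j 1 - A.a i 1 * A.a j 0 ≠ 0 → ∀ J : Finset (Fin d),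
        i ∈ J → j ∈ J → normalSpan A.normal J = ⊤ := fun i j hij J hi hj =>
      A.normalSpan_eq_top fun z hz =>
        HyperplaneArrangement.eq_zero_of_det_ne_zero hij (hz i hi) (hz j hj)
    have hspan : normalSpan A.normal Finset.univ = ⊤ := by
      unfold HyperplaneArrangement.AllParallel at hA
      push Not at hA
      obtain ⟨i, j, hij⟩ := hA
      refine htop i j (fun h => ?_) _ (Finset.mem_univ i) (Finset.mem_univ j)
      obtain ⟨u, hu⟩ := HyperplaneArrangement.exists_smul_eq_of_det_eq_zero (A.a_ne_zero i) h
      exact hij u hu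
    refine eq_empty_of_forall_notMem fun t ht => ht ?_
    unfold IsRegularValueAtInfinity
    rw [A.polyMap_defPoly]
    rcases eq_or_ne t 0 with rfl | ht0
    · exact affProd_fibration_zero A.normal A.c hspan A.normal_ne_zero
        fun i j hij z hi hj => htop i j (HyperplaneArrangement.det_ne_zero_of_meet hij hi hj)
    · exact affProd_fibration_of_ne_zero A.normal A.c hspan ht0
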